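/- Let $\Delta>0$, $c_1>0$, $c_2\ge 0$ be real numbers with $\frac{c_2}{c_1}\Delta^2\le \frac53$, and let $\nu$ be the finite Borel measure supported in $[-\Delta,\Delta]$ given by $d\nu(\alpha)=c_1\boldsymbol\delta(\alpha)+c_2|\alpha|\,d\alpha$, where $\boldsymbol\delta$ is the Dirac measure at the origin. Write $\widehat\nu(x)=\int_{\mathbb R}e^{-2\pi i x\alpha}\,d\nu(\alpha)$. Let $\mathcal H_\nu$ be the set of entire functions $f$ of exponential type at most $\pi\Delta$ (that is, for every $\varepsilon>0$ there is a constant $C_\varepsilon$ with $|f(z)|\le C_\varepsilon e^{(\pi\Delta+\varepsilon)|z|}$ for all $z\in\mathbb C$) such that $\int_{\mathbb R}|f(x)|^2\,\widehat\nu(x)\,dx<\infty$, and, for $f,g\in\mathcal H_\nu$, put $\langle f,g\rangle_\nu=\int_{\mathbb R}f(x)\overline{g(x)}\,\widehat\nu(x)\,dx$. Then $\mathcal H_\nu$ has a unique reproducing kernel, i.e. there is exactly one function $K_\nu:\mathbb C^2\to\mathbb C$ such that, for every $w\in\mathbb C$, $K_\nu(w,\cdot)\in\mathcal H_\nu$ and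 $f(w)=\langle f,K_\nu(w,\cdot)\rangle_\nu$ for all $f\in\mathcal H_\nu$. If $c_2>0$, then $$K_\nu(0,0)=\sqrt{\frac{2}{c_1c_2}}\;\frac{\sin\left(\sqrt{\frac{c_2}{2c_1}}\,\Delta\right)}{\cos\left(\sqrt{\frac{c_2}{2c_1}}\,\Delta\right)+\sqrt{\frac{c_2}{2c_1}}\,\Delta\,\sin\left(\sqrt{\frac{c_2}{2c_1}}\,\Delta\right)},$$ and if $c_2=0$, then $K_\nu(0,0)=\frac{\Delta}{c_1}$, the limit of this expression as $c_2\to0^+$. -/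

import Mathlib

open MeasureTheory

noncomputable section

/-- The finite Borel measure `c₁ δ₀ + c₂ |α| dα` on the line, supported in `[-Δ, Δ]`. -/
def pairMeasure (Δ c₁ c₂ : ℝ) : Measure ℝ :=
  ENNReal.ofReal c₁ • Measure.dirac 0 +
    (volume.restrict (Set.Icc (-Δ) Δ)).withDensity (fun α => ENNReal.ofReal (c₂ * |α|))

/-- The Fourier transform `ν̂(x) = ∫ e^{-2πixα} dν(α)` of a Borel measure on the line. -/
def measureFourier (ν : Measure ℝ) (x : ℝ) : ℂ :=
  ∫ α : ℝ, Complex.exp (-(2 * Real.pi * Complex.I * x * α)) ∂ν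

/-- `f` is an entire function of exponential type at most `τ`. -/
def IsEntireOfExpType (τ : ℝ) (f : ℂ → ℂ) : Prop :=
  Differentiable ℂ f ∧
    ∀ ε : ℝ, 0 < ε → ∃ C : ℝ, ∀ z : ℂ, ‖f z‖ ≤ C * Real.exp ((τ + ε) * ‖z‖)

/-- The set `H_ν` of entire functions `f` of exponential type at most `πΔ` such that
`∫ |f(x)|² ν̂(x) dx` is finite. -/
def weightedSpace (Δ : ℝ) (ν : Measure ℝ) : Set (ℂ → ℂ) :=
  {f | IsEntireOfExpType (Real.pi * Δ) f ∧
    Integrable (fun x : ℝ => ((‖f x‖ ^ 2 : ℝ) : ℂ) * measureFourier ν x)}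

/-- The pairing `⟨f, g⟩_ν = ∫ f(x) conj(g(x)) ν̂(x) dx`. -/
def weightedInner (ν : Measure ℝ) (f g : ℂ → ℂ) : ℂ :=
  ∫ x : ℝ, f x * (starRingEnd ℂ) (g x) * measureFourier ν x

/-- `K` is a reproducing kernel of `H_ν`: `K(w, ·) ∈ H_ν` and `f(w) = ⟨f, K(w, ·)⟩_ν` for all
`f ∈ H_ν` and all `w ∈ ℂ`. -/
def IsReproducingKernel (Δ : ℝ) (ν : Measure ℝ) (K : ℂ → ℂ → ℂ) : Prop :=
  ∀ w : ℂ, K w ∈ weightedSpace Δ ν ∧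
    ∀ f ∈ weightedSpace Δ ν, f w = weightedInner ν f (K w)

end

/-!
The weight `ν̂` is real, continuous and bounded, and the hypothesis `c₂ Δ² / c₁ ≤ 5 / 3` keeps it
above the positive constant `c₁ / 3000` (`pairWeight_lower_bound`). Hence `H_ν` is, as a set, the
Paley–Wiener space of entire functions of exponential type at most `πΔ` that are square integrable
on the line, and its norm is equivalent to the norm of `L²(ℝ)`.

By the Paley–Wiener theorem (`eq_bandSynthesis_fourier`) these functions are the integrals `f(z) =
∫ φ(t) e^{2πitz} dt` over `[-Δ/2, Δ/2]` with `φ` in `L²`. Its proof bounds `f` by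
Phragmén–Lindelöf applied to a primitive, moves the contour of the Fourier integral of `f(z) (is /
(z + is))³` to infinity, and lets `s → ∞`. The form `⟨f, g⟩_ν` becomes a bounded coercive form in
the spectra, and evaluation at `w` becomes the pairing with an `L²` function, so the kernel exists
(`exists_reproducing_element`). Testing on the difference of two kernels gives uniqueness.

For the value at the origin, multiplication by `ν̂` is convolution of the spectrum with `ν`, whose
truncation to `[-Δ, Δ]` is invisible to spectra on `[-Δ/2, Δ/2]`. Therefore `K(0, ·)` has as
spectrum the solution `u` of `c₁ u(s) + c₂ ∫ |s - t| u(t) dt = 1` on `[-Δ/2, Δ/2]`, which is a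
multiple of `cos(2lt)` with `l² = c₂ / (2 c₁)`, and `K(0, 0) = ∫ u`.
-/

open MeasureTheory Filter Topology
open scoped FourierTransform ContDiff SchwartzMap ComplexInnerProductSpace ENNReal Convolution

/-! ### The `L²` Fourier transform as an integral -/

theorem Real.integral_fourier_mul {f g : ℝ → ℂ} (hf : Integrable f) (hg : Integrable g) :
    ∫ x, 𝓕 g x * f x = ∫ x, g x * 𝓕 f x := by
  have := VectorFourier.integral_fourierIntegral_smul_eq_flip (L := innerₗ ℝ) (μ := volume)
    (ν := volume) (f := g) (g := f) Real.continuous_fourierChar (by fun_prop) hg hf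
  simpa [Real.fourier_eq, VectorFourier.fourierIntegral, mul_comm] using this

/-- The inverse Fourier integral moves across the pairing `∫ f g`, like the Fourier integral. -/
theorem Real.integral_fourierInv_mul {f g : ℝ → ℂ} (hf : Integrable f) (hg : Integrable g) :
    ∫ x, 𝓕⁻ g x * f x = ∫ x, g x * 𝓕⁻ f x := by
  simp_rw [Real.fourierInv_eq_fourier_comp_neg f, ← Real.integral_fourier_mul hf.comp_neg hg,
    Real.fourierInv_eq_fourier_neg g]
  rw [← integral_neg_eq_self]
  simp

theorem Lp.integral_fourier_mul (f : Lp ℂ 2 (volume : Measure ℝ)) (g : 𝓢(ℝ, ℂ)) :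
    ∫ x, g x * (𝓕 f : Lp ℂ 2 (volume : Measure ℝ)) x = ∫ x, 𝓕 (g : ℝ → ℂ) x * f x := by
  have := congrArg (fun T => T g) (Lp.fourier_toTemperedDistribution_eq f)
  simp only [Lp.toTemperedDistribution_apply, TemperedDistribution.fourier_apply, smul_eq_mul,
    SchwartzMap.fourier_coe] at this
  exact this.symm

theorem Lp.integral_fourierInv_mul (f : Lp ℂ 2 (volume : Measure ℝ)) (g : 𝓢(ℝ, ℂ)) :
    ∫ x, g x * (𝓕⁻ f : Lp ℂ 2 (volume : Measure ℝ)) x = ∫ x, 𝓕⁻ (g : ℝ → ℂ) x * f x := by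
  have := congrArg (fun T => T g) (Lp.fourierInv_toTemperedDistribution_eq f)
  simp only [Lp.toTemperedDistribution_apply, TemperedDistribution.fourierInv_apply, smul_eq_mul,
    SchwartzMap.fourierInv_coe] at this
  exact this.symm

/-- Locally integrable functions that agree as tempered distributions agree almost everywhere. -/
theorem ae_eq_of_integral_schwartz_mul_eq {f g : ℝ → ℂ} (hf : LocallyIntegrable f)
    (hg : LocallyIntegrable g) (h : ∀ G : 𝓢(ℝ, ℂ), ∫ x, G x * f x = ∫ x, G x * g x) :
    f =ᵐ[volume] g := by
  refine ae_eq_of_integral_contDiff_smul_eq hf hg fun u hu huc => ?_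
  have hg₁ : HasCompactSupport (Complex.ofRealCLM ∘ u) := huc.comp_left rfl
  have hg₂ : ContDiff ℝ ∞ (Complex.ofRealCLM ∘ u) := by fun_prop
  simpa using h (hg₁.toSchwartzMap hg₂)

theorem continuous_fourier {f : ℝ → ℂ} (hf : Integrable f) : Continuous (𝓕 f) :=
  VectorFourier.fourierIntegral_continuous Real.continuous_fourierChar (by fun_prop) hf

theorem continuous_fourierInv {f : ℝ → ℂ} (hf : Integrable f) : Continuous (𝓕⁻ f) := by
  rw [Real.fourierInv_eq_fourier_comp_neg]
  exact continuous_fourier hf.comp_neg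

/-- On `L¹ ∩ L²` the `L²` Fourier transform, which Mathlib defines by extension from Schwartz
functions, is given by the Fourier integral. -/
theorem fourier_toLp_ae_eq {f : ℝ → ℂ} (h1 : Integrable f) (h2 : MemLp f 2) :
    (𝓕 (h2.toLp f) : Lp ℂ 2 (volume : Measure ℝ)) =ᵐ[volume] 𝓕 f := by
  refine ae_eq_of_integral_schwartz_mul_eq ((Lp.memLp _).locallyIntegrable (by norm_num))
    (continuous_fourier h1).locallyIntegrable fun G => ?_
  rw [Lp.integral_fourier_mul, ← Real.integral_fourier_mul h1 G.integrable]
  refine integral_congr_ae ?_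
  filter_upwards [h2.coeFn_toLp] with x hx
  rw [hx]

/-- On `L¹ ∩ L²` the inverse `L²` Fourier transform is given by the inverse Fourier integral. -/
theorem fourierInv_toLp_ae_eq {f : ℝ → ℂ} (h1 : Integrable f) (h2 : MemLp f 2) :
    (𝓕⁻ (h2.toLp f) : Lp ℂ 2 (volume : Measure ℝ)) =ᵐ[volume] 𝓕⁻ f := by
  refine ae_eq_of_integral_schwartz_mul_eq ((Lp.memLp _).locallyIntegrable (by norm_num))
    (continuous_fourierInv h1).locallyIntegrable fun G => ?_
  rw [Lp.integral_fourierInv_mul, ← Real.integral_fourierInv_mul h1 G.integrable]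
  refine integral_congr_ae ?_
  filter_upwards [h2.coeFn_toLp] with x hx
  rw [hx]

/-! ### Growth of entire functions and a contour integral -/

theorem one_add_norm_le_two_mul_norm_add_one {ζ : ℂ} (hζ : 0 ≤ ζ.re) :
    1 + ‖ζ‖ ≤ 2 * ‖ζ + 1‖ := by
  have h1 : 1 ≤ ‖ζ + 1‖ := by
    refine le_trans ?_ (Complex.abs_re_le_norm _)
    rw [Complex.add_re, Complex.one_re, abs_of_nonneg (by linarith)]
    linarith
  have h2 : ‖ζ‖ ≤ ‖ζ + 1‖ := by
    rw [Complex.norm_def, Complex.norm_def]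
    apply Real.sqrt_le_sqrt
    simp only [Complex.normSq_apply, Complex.add_re, Complex.one_re, Complex.add_im, Complex.one_im]
    nlinarith
  linarith

/-- Phragmén–Lindelöf in the upper half-plane: an entire function of exponential type that grows at
most linearly on the real line grows like `(1 + ‖z‖) e^{σ Im z}` above it. -/
theorem norm_le_of_expType_of_linear_growth_of_im_nonneg {F : ℂ → ℂ}
    (hF : Differentiable ℂ F) {σ C M : ℝ}
    (hσ : 0 ≤ σ) (hC : ∀ z, ‖F z‖ ≤ C * (1 + ‖z‖) * Real.exp (σ * ‖z‖))
    (hM : ∀ x : ℝ, ‖F x‖ ≤ M * (1 + |x|)) {z : ℂ} (hz : 0 ≤ z.im) :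
    ‖F z‖ ≤ 4 * M * (1 + ‖z‖) * Real.exp (σ * z.im) := by
  have hC0 : 0 ≤ C := by simpa using (norm_nonneg _).trans (hC 0)
  -- With `z = iζ` the upper half-plane becomes the right one. Dividing by `ζ + 1` removes the
  -- linear growth on the boundary, and the factor `e^{-σζ}` removes the growth along the positive axis.
  set H : ℂ → ℂ := fun ζ => F (Complex.I * ζ) / (ζ + 1) * Complex.exp (-(σ * ζ)) with hH
  have hne : ∀ ζ : ℂ, 0 ≤ ζ.re → ζ + 1 ≠ 0 := fun ζ h h' => by
    have := congrArg Complex.re h'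
    simp at this
    linarith
  have hnorm : ∀ ζ : ℂ, ‖H ζ‖ = ‖F (Complex.I * ζ)‖ / ‖ζ + 1‖ * Real.exp (-(σ * ζ.re)) := by
    intro ζ
    simp [hH, Complex.norm_exp]
  have hbd : ∀ ζ : ℂ, 0 ≤ ζ.re →
      ‖H ζ‖ ≤ 2 * C * Real.exp (σ * ‖ζ‖) * Real.exp (-(σ * ζ.re)) := by
    intro ζ h
    rw [hnorm]
    gcongr
    have h1 := one_add_norm_le_two_mul_norm_add_one h
    rw [div_le_iff₀ (norm_pos_iff.2 (hne ζ h))]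
    refine (hC _).trans ?_
    rw [norm_mul, Complex.norm_I, one_mul]
    calc C * (1 + ‖ζ‖) * Real.exp (σ * ‖ζ‖) ≤ C * (2 * ‖ζ + 1‖) * Real.exp (σ * ‖ζ‖) := by gcongr
      _ = _ := by ring
  have key : ∀ ζ : ℂ, 0 ≤ ζ.re → ‖H ζ‖ ≤ 2 * M := by
    intro ζ hζ
    refine PhragmenLindelof.right_half_plane_of_bounded_on_real (f := H) ?_ ?_ ?_ ?_ hζ
    · apply DifferentiableOn.diffContOnCl
      rw [Complex.closure_setOfPred_lt_re]
      intro ζ hζ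
      apply DifferentiableAt.differentiableWithinAt
      have := hne ζ hζ
      have h2 := hF (Complex.I * ζ)
      refine DifferentiableAt.mul (DifferentiableAt.div (DifferentiableAt.comp ζ h2 (by fun_prop))
        (by fun_prop) this) (by fun_prop)
    · refine ⟨1, by norm_num, σ, Asymptotics.IsBigO.of_bound (2 * C) ?_⟩
      rw [eventually_inf_principal]
      refine Eventually.of_forall fun ζ hζ => (hbd ζ (le_of_lt hζ)).trans ?_
      have : Real.exp (-(σ * ζ.re)) ≤ 1 :=
        Real.exp_le_one_iff.2 (by have : 0 < ζ.re := hζ; nlinarith)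
      rw [Real.rpow_one, Real.norm_of_nonneg (Real.exp_nonneg _)]
      exact mul_le_of_le_one_right (by positivity) this
    · refine isBoundedUnder_of_eventually_le (a := 2 * C) ?_
      filter_upwards [eventually_ge_atTop 0] with x hx
      refine (hbd x (by simpa using hx)).trans (le_of_eq ?_)
      rw [Complex.norm_real, Real.norm_of_nonneg hx, Complex.ofReal_re, mul_assoc, ← Real.exp_add]
      simp
    · intro x
      rw [hnorm]
      have h0 : (0 : ℝ) ≤ (x * Complex.I : ℂ).re := by simp
      have h1 := one_add_norm_le_two_mul_norm_add_one h0
      have h2 : Complex.I * (x * Complex.I) = ((-x : ℝ) : ℂ) := by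
        push_cast
        linear_combination (x : ℂ) * Complex.I_mul_I
      have h3 := hM (-x)
      have hM0 : 0 ≤ M := by simpa using (norm_nonneg _).trans (hM 0)
      rw [h2, show (x * Complex.I : ℂ).re = 0 by simp]
      simp only [mul_zero, neg_zero, Real.exp_zero, mul_one]
      rw [div_le_iff₀ (norm_pos_iff.2 (hne _ h0))]
      refine h3.trans ?_
      have h4 : ‖(x * Complex.I : ℂ)‖ = |x| := by simp
      rw [h4] at h1
      rw [abs_neg]
      calc M * (1 + |x|) ≤ M * (2 * ‖(x * Complex.I : ℂ) + 1‖) := by gcongr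
        _ = _ := by ring
  have hre : (-Complex.I * z).re = z.im := by simp
  have h1 := key (-Complex.I * z) (by rw [hre]; exact hz)
  have h2 : Complex.I * (-Complex.I * z) = z := by linear_combination (-z) * Complex.I_mul_I
  rw [hnorm, hre, h2, Real.exp_neg, ← div_eq_mul_inv, div_le_iff₀ (Real.exp_pos _),
    div_le_iff₀ (norm_pos_iff.2 (hne _ (by rw [hre]; exact hz)))] at h1
  have hM0 : 0 ≤ M := by simpa using (norm_nonneg _).trans (hM 0)
  have h3 : ‖-Complex.I * z + 1‖ ≤ 2 * (1 + ‖z‖) := by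
    refine (norm_add_le _ _).trans ?_
    simp only [norm_mul, norm_neg, Complex.norm_I, norm_one]
    linarith [norm_nonneg z]
  calc ‖F z‖ ≤ 2 * M * Real.exp (σ * z.im) * ‖-Complex.I * z + 1‖ := h1
    _ ≤ 2 * M * Real.exp (σ * z.im) * (2 * (1 + ‖z‖)) := by gcongr
    _ = _ := by ring

theorem norm_le_of_expType_of_linear_growth {F : ℂ → ℂ} (hF : Differentiable ℂ F) {σ C M : ℝ}
    (hσ : 0 ≤ σ) (hC : ∀ z, ‖F z‖ ≤ C * (1 + ‖z‖) * Real.exp (σ * ‖z‖))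
    (hM : ∀ x : ℝ, ‖F x‖ ≤ M * (1 + |x|)) (z : ℂ) :
    ‖F z‖ ≤ 4 * M * (1 + ‖z‖) * Real.exp (σ * |z.im|) := by
  rcases le_total 0 z.im with h | h
  · rw [abs_of_nonneg h]
    exact norm_le_of_expType_of_linear_growth_of_im_nonneg hF hσ hC hM h
  · have := norm_le_of_expType_of_linear_growth_of_im_nonneg (F := fun z => F (-z))
      (hF.comp differentiable_neg) hσ (C := C) (M := M) (fun z => by simpa using hC (-z))
      (fun x => by simpa using hM (-x))
      (z := -z) (by simpa using h)
    simpa [abs_of_nonpos h] using this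

/-- An entire function of exponential type `τ` that is square integrable on the line is bounded by
`M (1 + ‖z‖) e^{σ |Im z|}` for every `σ > τ`. Square integrability gives no pointwise bound on the
line directly, but it makes the primitive grow at most linearly there; Phragmén–Lindelöf applies to
the primitive, and the Cauchy estimate on unit discs returns to the function. -/
theorem norm_le_of_expType_of_integrable_sq {f : ℂ → ℂ} {τ : ℝ} (hτ : 0 ≤ τ)
    (hf : IsEntireOfExpType τ f) (h2 : Integrable fun x : ℝ => ‖f x‖ ^ 2) {σ : ℝ} (hσ : τ < σ) :
    ∃ M, 0 ≤ M ∧ ∀ z, ‖f z‖ ≤ M * (1 + ‖z‖) * Real.exp (σ * |z.im|) := by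
  obtain ⟨C, hC⟩ := hf.2 (σ - τ) (by linarith)
  rw [add_sub_cancel] at hC
  have hC0 : 0 ≤ C := by simpa using (norm_nonneg _).trans (hC 0)
  have hσ0 : 0 ≤ σ := by linarith
  obtain ⟨F, hF0, hF⟩ := hf.1.isExactOn_univ.with_val_at 0 0
  have hF' : ∀ z, HasDerivAt F (f z) z := fun z => hF z trivial
  have hFd : Differentiable ℂ F := fun z => (hF' z).differentiableAt
  have h1 : ∀ z, ‖F z‖ ≤ C * (1 + ‖z‖) * Real.exp (σ * ‖z‖) := by
    intro z
    have := (convex_closedBall (0 : ℂ) ‖z‖).norm_image_sub_le_of_norm_hasDerivWithin_le (f := F)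
      (f' := f) (C := C * Real.exp (σ * ‖z‖)) (x := 0) (y := z)
      (fun x _ => (hF' x).hasDerivWithinAt) (fun x hx => ?_) (by simp) (by simp)
    · rw [hF0, sub_zero, sub_zero] at this
      refine this.trans ?_
      calc C * Real.exp (σ * ‖z‖) * ‖z‖ = C * ‖z‖ * Real.exp (σ * ‖z‖) := by ring
        _ ≤ _ := by gcongr; linarith
    · refine (hC x).trans ?_
      have : ‖x‖ ≤ ‖z‖ := by simpa using hx
      gcongr
  set I := ∫ x : ℝ, ‖f x‖ ^ 2 with hI
  have hI0 : 0 ≤ I := integral_nonneg fun _ => by positivity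
  have hcont : Continuous fun x : ℝ => f x := hf.1.continuous.comp Complex.continuous_ofReal
  have h3 : ∀ x : ℝ, ‖F x‖ ≤ (1 + I) * (1 + |x|) := by
    intro x
    have e : ∫ t in (0 : ℝ)..x, f t = F x := by
      rw [intervalIntegral.integral_eq_sub_of_hasDerivAt (f := fun t : ℝ => F t)
        (fun t _ => (hF' t).comp_ofReal) (hcont.intervalIntegrable _ _)]
      simp [hF0]
    rw [← e]
    calc ‖∫ t in (0 : ℝ)..x, f t‖ ≤ ∫ t in Set.uIoc 0 x, ‖f t‖ :=
          intervalIntegral.norm_integral_le_integral_norm_uIoc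
      _ ≤ ∫ t in Set.uIoc 0 x, (1 + ‖f t‖ ^ 2) := by
          refine setIntegral_mono ?_ ?_ fun t => ?_
          · exact (intervalIntegrable_iff.1 (hcont.norm.intervalIntegrable _ _))
          · exact (intervalIntegrable_iff.1
              ((continuous_const.add (hcont.norm.pow 2)).intervalIntegrable _ _))
          · nlinarith [sq_nonneg (‖f t‖ - 1)]
      _ = |x| + ∫ t in Set.uIoc 0 x, ‖f t‖ ^ 2 := by
          rw [integral_add _ h2.integrableOn]
          · simp [Set.uIoc, measureReal_def, max_sub_min_eq_abs']
          · exact (integrableOn_const (by simp [Set.uIoc]))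
      _ ≤ |x| + I := by
          gcongr
          exact setIntegral_le_integral h2 (Eventually.of_forall fun _ => by positivity)
      _ ≤ _ := by nlinarith [abs_nonneg x]
  have h4 := norm_le_of_expType_of_linear_growth hFd hσ0 h1 h3
  refine ⟨8 * (1 + I) * Real.exp σ, by positivity, fun z => ?_⟩
  have h5 := Complex.norm_deriv_le_of_forall_mem_sphere_norm_le (c := z) (f := F) zero_lt_one
    hFd.diffContOnCl (C := 8 * (1 + I) * Real.exp σ * (1 + ‖z‖) * Real.exp (σ * |z.im|))
    (fun w hw => ?_)
  · rwa [(hF' z).deriv, div_one] at h5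
  · have hw' : ‖w - z‖ = 1 := by simpa [dist_eq_norm] using hw
    have hn : ‖w‖ ≤ 1 + ‖z‖ := by
      have := norm_add_le (w - z) z
      rw [sub_add_cancel] at this
      linarith
    have him : |w.im| ≤ 1 + |z.im| := by
      have h6 := Complex.abs_im_le_norm (w - z)
      have h7 := abs_add_le (w - z).im z.im
      rw [Complex.sub_im, sub_add_cancel] at h7
      rw [Complex.sub_im] at h6
      linarith
    calc ‖F w‖ ≤ 4 * (1 + I) * (1 + ‖w‖) * Real.exp (σ * |w.im|) := h4 w
      _ ≤ 4 * (1 + I) * (2 * (1 + ‖z‖)) * Real.exp (σ * (1 + |z.im|)) := by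
          gcongr
          linarith [norm_nonneg z]
      _ = _ := by rw [mul_add σ, Real.exp_add, mul_one]; ring

/-- A function holomorphic in the closed upper half-plane and `O(‖z‖⁻²)` there has integral zero
over the real line. -/
theorem integral_eq_zero_of_differentiableOn_upperHalfPlane {G : ℂ → ℂ} {C : ℝ}
    (hG : DifferentiableOn ℂ G {z | 0 ≤ z.im})
    (hC : ∀ z : ℂ, 0 ≤ z.im → ‖G z‖ ≤ C / (1 + ‖z‖ ^ 2)) :
    ∫ x : ℝ, G x = 0 := by
  have hC0 : 0 ≤ C := by simpa using (norm_nonneg _).trans (hC 0 (by simp))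
  have hcont : Continuous fun x : ℝ => G x :=
    hG.continuousOn.comp_continuous Complex.continuous_ofReal fun x => by simp
  have hint : Integrable fun x : ℝ => G x := by
    refine (integrable_inv_one_add_sq.const_mul C).mono' hcont.aestronglyMeasurable
      (Eventually.of_forall fun x => ?_)
    simpa [div_eq_mul_inv] using hC x (by simp)
  have hlim := intervalIntegral_tendsto_integral hint tendsto_neg_atTop_atBot tendsto_id
  refine tendsto_nhds_unique hlim (squeeze_zero_norm' (a := fun R : ℝ => 4 * C * R⁻¹) ?_ ?_)
  · filter_upwards [eventually_gt_atTop 0] with R hR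
    have hR' : (-R : ℂ) = ((-R : ℝ) : ℂ) := by push_cast; rfl
    -- Cauchy on the square `[-R, R] × [0, R]`: its three upper sides contribute `O(1 / R)`.
    have hrect := Complex.integral_boundary_rect_eq_zero_of_differentiableOn G (-R)
      (R + R * Complex.I) (hG.mono fun z hz => by
        have := hz.2
        simp only [Complex.neg_im, Complex.ofReal_im, neg_zero, Complex.add_im, Complex.mul_im,
          Complex.ofReal_re, Complex.I_im, mul_one, Complex.I_re, mul_zero, add_zero, zero_add,
          Set.mem_preimage, Set.uIcc_of_le hR.le] at this
        exact this.1)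
    simp only [Complex.neg_im, Complex.ofReal_im, neg_zero, Complex.add_im, Complex.mul_im,
          Complex.ofReal_re, Complex.I_im, mul_one, Complex.I_re, mul_zero, add_zero, zero_add,
          Complex.neg_re, Complex.add_re, Complex.mul_re, sub_self, Complex.ofReal_zero, zero_mul]
      at hrect
    have hb : ∀ z : ℂ, 0 ≤ z.im → R ≤ ‖z‖ → ‖G z‖ ≤ C / R ^ 2 := fun z hz hzR =>
      (hC z hz).trans (by gcongr; nlinarith)
    have htop : ‖∫ x : ℝ in -R..R, G (x + R * Complex.I)‖ ≤ C / R ^ 2 * |R - -R| := by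
      refine intervalIntegral.norm_integral_le_of_norm_le_const fun x _ => hb _ (by simp [hR.le]) ?_
      refine le_trans ?_ (Complex.abs_im_le_norm _)
      simp [abs_of_pos hR]
    have hright : ‖∫ y : ℝ in 0..R, G (R + y * Complex.I)‖ ≤ C / R ^ 2 * |R - 0| := by
      refine intervalIntegral.norm_integral_le_of_norm_le_const fun y hy => hb _ ?_ ?_
      · rw [Set.uIoc_of_le hR.le] at hy
        simpa using hy.1.le
      · refine le_trans ?_ (Complex.abs_re_le_norm _)
        simp [abs_of_pos hR]
    have hleft : ‖∫ y : ℝ in 0..R, G (((-R : ℝ) : ℂ) + y * Complex.I)‖ ≤ C / R ^ 2 * |R - 0| := by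
      refine intervalIntegral.norm_integral_le_of_norm_le_const fun y hy => hb _ ?_ ?_
      · rw [Set.uIoc_of_le hR.le] at hy
        simpa using hy.1.le
      · refine le_trans ?_ (Complex.abs_re_le_norm _)
        simp [abs_of_pos hR]
    have heq : ∫ x : ℝ in -R..R, G x = (∫ x : ℝ in -R..R, G (x + R * Complex.I))
        - Complex.I * (∫ y : ℝ in 0..R, G (R + y * Complex.I))
        + Complex.I * (∫ y : ℝ in 0..R, G (((-R : ℝ) : ℂ) + y * Complex.I)) := by
      simp only [smul_eq_mul] at hrect
      push_cast at hrect ⊢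
      linear_combination hrect
    rw [id, heq]
    have e1 : C / R ^ 2 * |R - -R| = 2 * C * R⁻¹ := by
      rw [abs_of_pos (by linarith)]; field_simp; ring
    have e2 : C / R ^ 2 * |R - 0| = C * R⁻¹ := by
      rw [sub_zero, abs_of_pos hR]; field_simp
    rw [e1] at htop
    rw [e2] at hright hleft
    refine (norm_add_le _ _).trans ((add_le_add_left (norm_sub_le _ _) _).trans ?_)
    rw [norm_mul, norm_mul, Complex.norm_I, one_mul, one_mul]
    linarith
  · simpa using (tendsto_inv_atTop_zero (𝕜 := ℝ)).const_mul (4 * C)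

/-! ### Support of the Fourier transform -/

/-- The factor `is / (z + is)`: holomorphic in the upper half-plane for `s > 0`, of modulus at most
`1` on the real line, decaying like `‖z‖⁻¹`, and tending to `1` as `s → ∞`. -/
noncomputable def halfPlaneMollifier (s : ℝ) (z : ℂ) : ℂ := s * Complex.I / (z + s * Complex.I)

theorem halfPlaneMollifier_denom_ne_zero {s : ℝ} (hs : 0 < s) {z : ℂ} (hz : 0 ≤ z.im) :
    z + s * Complex.I ≠ 0 := fun h => by
  have := congrArg Complex.im h
  simp at this
  linarith

theorem norm_halfPlaneMollifier_le {s : ℝ} (hs : 1 ≤ s) {z : ℂ} (hz : 0 ≤ z.im) :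
    ‖halfPlaneMollifier s z‖ ≤ 2 * s / (1 + ‖z‖) := by
  have h1 : s ≤ ‖z + s * Complex.I‖ := by
    refine le_trans ?_ (Complex.abs_im_le_norm _)
    simp only [Complex.add_im, Complex.mul_im, Complex.ofReal_re, Complex.I_im, mul_one,
      Complex.ofReal_im, Complex.I_re, mul_zero, add_zero]
    rw [abs_of_nonneg (by linarith)]
    linarith
  have h2 : ‖z‖ ≤ ‖z + s * Complex.I‖ := by
    rw [Complex.norm_def, Complex.norm_def]
    apply Real.sqrt_le_sqrt
    simp only [Complex.normSq_apply, Complex.add_re, Complex.mul_re, Complex.ofReal_re,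
      Complex.I_re, mul_zero, Complex.ofReal_im, Complex.I_im, mul_one, sub_self, add_zero,
      Complex.add_im, Complex.mul_im]
    nlinarith
  have h3 : 0 < ‖z + s * Complex.I‖ := by linarith
  rw [halfPlaneMollifier, norm_div, div_le_div_iff₀ h3 (by positivity)]
  simp only [norm_mul, Complex.norm_real, Complex.norm_I, mul_one, Real.norm_eq_abs]
  rw [abs_of_nonneg (by linarith)]
  nlinarith

theorem norm_halfPlaneMollifier_ofReal_le_one (s x : ℝ) : ‖halfPlaneMollifier s x‖ ≤ 1 := by
  rw [halfPlaneMollifier, norm_div]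
  refine div_le_one_of_le₀ ?_ (norm_nonneg _)
  rw [Complex.norm_def, Complex.norm_def]
  apply Real.sqrt_le_sqrt
  simp [Complex.normSq_apply]
  nlinarith [mul_self_nonneg x]

theorem continuous_halfPlaneMollifier {s : ℝ} (hs : 0 < s) :
    Continuous fun x : ℝ => halfPlaneMollifier s x := by
  unfold halfPlaneMollifier
  exact continuous_const.div (by fun_prop) fun x =>
    halfPlaneMollifier_denom_ne_zero hs (by simp)

theorem tendsto_halfPlaneMollifier (x : ℝ) :
    Tendsto (fun n : ℕ => halfPlaneMollifier (n + 1) x) atTop (𝓝 1) := by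
  have h : Tendsto (fun n : ℕ =>
      (1 : ℂ) / ((x : ℂ) / Complex.I * (((1 : ℝ) / ((n : ℝ) + 1) : ℝ) : ℂ) + 1)) atTop
      (𝓝 (1 / ((x : ℂ) / Complex.I * ((0 : ℝ) : ℂ) + 1))) := by
    refine Tendsto.div tendsto_const_nhds ?_ (by simp)
    refine (Tendsto.const_mul _ ?_).add_const _
    exact (Complex.continuous_ofReal.tendsto 0).comp tendsto_one_div_add_atTop_nhds_zero_nat
  simp only [Complex.ofReal_zero, mul_zero, zero_add, div_one] at h
  refine h.congr fun n => ?_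
  have h1 : (n : ℂ) + 1 ≠ 0 := by exact_mod_cast n.succ_ne_zero
  rw [halfPlaneMollifier]
  have h2 := halfPlaneMollifier_denom_ne_zero (s := n + 1) (by positivity) (z := x) (by simp)
  push_cast at h2 ⊢
  rw [div_eq_div_iff _ h2]
  · field_simp
  · intro h3
    apply h2
    field_simp at h3
    linear_combination h3

/-- After multiplication by three factors `is / (z + is)` (one for the linear growth of `f`, two for
integrability), the contour of the Fourier integral at `t < -h` can be pushed to `+i∞`, where
`e^{-2πitz}` decays faster than `f` grows. -/
theorem fourier_mollified_eq_zero {f : ℂ → ℂ} {h : ℝ} (hh : 0 ≤ h)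
    (hf : IsEntireOfExpType (2 * Real.pi * h) f) (h2 : Integrable fun x : ℝ => ‖f x‖ ^ 2)
    {s : ℝ} (hs : 1 ≤ s) {t : ℝ} (ht : t < -h) :
    𝓕 (fun x : ℝ => f x * halfPlaneMollifier s x ^ 3) t = 0 := by
  have hpi := Real.pi_pos
  obtain ⟨M, hM0, hM⟩ := norm_le_of_expType_of_integrable_sq (by positivity) hf h2
    (σ := 2 * Real.pi * (-t)) (by gcongr; linarith)
  have key := integral_eq_zero_of_differentiableOn_upperHalfPlane
    (G := fun z => Complex.exp (-(2 * Real.pi * t * z) * Complex.I) *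
      (f z * halfPlaneMollifier s z ^ 3)) (C := M * (2 * s) ^ 3) ?_ ?_
  · rw [Real.fourier_eq', ← key]
    refine integral_congr_ae (Eventually.of_forall fun x => ?_)
    simp only [smul_eq_mul, RCLike.inner_apply, conj_trivial]
    congr 2
    push_cast
    ring
  · unfold halfPlaneMollifier
    intro z hz
    apply DifferentiableAt.differentiableWithinAt
    have h3 := halfPlaneMollifier_denom_ne_zero (s := s) (by linarith) hz
    have h4 := hf.1 z
    fun_prop (disch := assumption)
  · intro z hz
    have h3 := norm_halfPlaneMollifier_le hs hz
    have h4 := hM z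
    rw [abs_of_nonneg hz] at h4
    have h5 : ‖Complex.exp (-(2 * Real.pi * t * z) * Complex.I)‖
        = Real.exp (-(2 * Real.pi * (-t) * z.im)) := by
      rw [Complex.norm_exp]
      congr 1
      have : (-(2 * Real.pi * t * z) * Complex.I : ℂ)
        = ((2 * Real.pi * (-t) : ℝ) : ℂ) * (z * Complex.I) := by push_cast; ring
      rw [this, Complex.re_ofReal_mul]
      simp
    rw [norm_mul, norm_mul, norm_pow, h5]
    calc Real.exp (-(2 * Real.pi * (-t) * z.im)) * (‖f z‖ * ‖halfPlaneMollifier s z‖ ^ 3)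
        ≤ Real.exp (-(2 * Real.pi * (-t) * z.im)) *
          ((M * (1 + ‖z‖) * Real.exp (2 * Real.pi * (-t) * z.im)) * (2 * s / (1 + ‖z‖)) ^ 3) := by
          gcongr
      _ = M * (2 * s) ^ 3 / (1 + ‖z‖) ^ 2 := by
          rw [Real.exp_neg]
          have := Real.exp_pos (2 * Real.pi * (-t) * z.im)
          have : 0 < 1 + ‖z‖ := by positivity
          field_simp
      _ ≤ M * (2 * s) ^ 3 / (1 + ‖z‖ ^ 2) := by
          have := norm_nonneg z
          gcongr
          nlinarith

theorem integrable_mollified {f : ℂ → ℂ} {τ : ℝ} (hτ : 0 ≤ τ)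
    (hf : IsEntireOfExpType τ f) (h2 : Integrable fun x : ℝ => ‖f x‖ ^ 2)
    {s : ℝ} (hs : 1 ≤ s) :
    Integrable (fun x : ℝ => f x * halfPlaneMollifier s x ^ 3) := by
  obtain ⟨M, hM0, hM⟩ := norm_le_of_expType_of_integrable_sq hτ hf h2 (lt_add_one τ)
  have hcont : Continuous fun x : ℝ => f x := hf.1.continuous.comp Complex.continuous_ofReal
  refine (integrable_inv_one_add_sq.const_mul (M * (2 * s) ^ 3)).mono'
    (hcont.mul ((continuous_halfPlaneMollifier (by linarith)).pow 3)).aestronglyMeasurable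
    (Eventually.of_forall fun x => ?_)
  have h3 := norm_halfPlaneMollifier_le hs (z := x) (by simp)
  have h4 := hM x
  simp only [Complex.ofReal_im, abs_zero, mul_zero, Real.exp_zero, mul_one, Complex.norm_real,
    Real.norm_eq_abs] at h3 h4
  rw [norm_mul, norm_pow]
  calc ‖f x‖ * ‖halfPlaneMollifier s x‖ ^ 3
      ≤ (M * (1 + |x|)) * (2 * s / (1 + |x|)) ^ 3 := by gcongr
    _ = M * (2 * s) ^ 3 / (1 + |x|) ^ 2 := by
        have : 0 < 1 + |x| := by positivity
        field_simp
    _ ≤ M * (2 * s) ^ 3 / (1 + x ^ 2) := by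
        gcongr
        nlinarith [abs_nonneg x, sq_abs x]
    _ = _ := div_eq_mul_inv _ _

/-- If the multipliers `m n` are bounded by `1` and tend to `1` pointwise, then `f · m n` tends to
`f` weakly in `L²`. -/
theorem tendsto_inner_mul {f : ℝ → ℂ} (h2 : MemLp f 2) {m : ℕ → ℝ → ℂ}
    (hm : ∀ n x, ‖m n x‖ ≤ 1) (hmt : ∀ x, Tendsto (fun n => m n x) atTop (𝓝 1))
    (hfm : ∀ n, MemLp (fun x => f x * m n x) 2) (u : Lp ℂ 2 (volume : Measure ℝ)) :
    Tendsto (fun n => ⟪u, (hfm n).toLp _⟫) atTop (𝓝 ⟪u, h2.toLp _⟫) := by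
  have e : ∀ {g : ℝ → ℂ} (hg : MemLp g 2), ⟪u, hg.toLp g⟫ = ∫ x, g x * (starRingEnd ℂ) (u x) := by
    intro g hg
    rw [L2.inner_def]
    refine integral_congr_ae ?_
    filter_upwards [hg.coeFn_toLp] with x hx
    rw [hx, RCLike.inner_apply]
  simp_rw [e]
  refine tendsto_integral_of_dominated_convergence (fun x => ‖f x‖ * ‖u x‖)
    (fun n => (hfm n).1.mul
      (Complex.continuous_conj.comp_aestronglyMeasurable (Lp.aestronglyMeasurable u)))
    (h2.norm.integrable_mul (Lp.memLp u).norm)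
    (fun n => Eventually.of_forall fun x => ?_) (Eventually.of_forall fun x => ?_)
  · rw [norm_mul, norm_mul, RCLike.norm_conj]
    gcongr
    exact mul_le_of_le_one_right (norm_nonneg _) (hm n x)
  · simpa using ((hmt x).const_mul (f x)).mul_const ((starRingEnd ℂ) (u x))

/-- The vanishing of the Fourier transform on a set passes from the functions `f · m n` to their
weak limit `f`. -/
theorem fourier_ae_eq_zero_of_fourier_mul_eq_zero {f : ℝ → ℂ} (h2 : MemLp f 2) {m : ℕ → ℝ → ℂ}
    (hm : ∀ n x, ‖m n x‖ ≤ 1) (hmt : ∀ x, Tendsto (fun n => m n x) atTop (𝓝 1))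
    (hint : ∀ n, Integrable fun x => f x * m n x) {A : Set ℝ} (hA : MeasurableSet A)
    (h0 : ∀ n, ∀ t ∈ A, 𝓕 (fun x => f x * m n x) t = 0) :
    ∀ᵐ t : ℝ, t ∈ A → (𝓕 (h2.toLp f) : Lp ℂ 2 (volume : Measure ℝ)) t = 0 := by
  have hfm : ∀ n, MemLp (fun x => f x * m n x) 2 := fun n => by
    refine h2.mono (hint n).1 (Eventually.of_forall fun x => ?_)
    rw [norm_mul]
    exact mul_le_of_le_one_right (norm_nonneg _) (hm n x)
  set φ : Lp ℂ 2 (volume : Measure ℝ) := 𝓕 (h2.toLp f) with hφ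
  -- Test against the part `u` of `φ` that lives on `A`; then `⟪u, φ⟫ = ‖u‖²`.
  set u : Lp ℂ 2 (volume : Measure ℝ) := ((Lp.memLp φ).indicator hA).toLp _ with hu
  have hlim := tendsto_inner_mul h2 hm hmt hfm (𝓕⁻ u)
  have hF : ∀ g : Lp ℂ 2 (volume : Measure ℝ), ⟪𝓕⁻ u, g⟫ = ⟪u, 𝓕 g⟫ := fun g => by
    rw [← Lp.inner_fourier_eq, FourierTransform.fourier_fourierInv_eq]
  have huφ : u =ᵐ[volume] A.indicator φ := MemLp.coeFn_toLp _
  have hz : ∀ n : ℕ, ⟪𝓕⁻ u, (hfm n).toLp _⟫ = 0 := by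
    intro n
    rw [hF, L2.inner_def]
    refine integral_eq_zero_of_ae ?_
    filter_upwards [huφ, fourier_toLp_ae_eq (hint n) (hfm n)] with t ht1 ht2
    rw [ht1, ht2]
    by_cases ht : t ∈ A
    · simp [h0 n t ht]
    · simp [ht]
  simp_rw [hz, hF] at hlim
  have h0 : ⟪u, φ⟫ = 0 := tendsto_nhds_unique hlim tendsto_const_nhds
  have h1 : ⟪u, u⟫ = 0 := by
    rw [← h0, L2.inner_def, L2.inner_def]
    refine integral_congr_ae ?_
    filter_upwards [huφ] with t ht1
    rw [ht1]
    by_cases ht : t ∈ A <;> simp [ht]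
  rw [inner_self_eq_zero] at h1
  rw [h1] at huφ
  filter_upwards [huφ, Lp.coeFn_zero ℂ 2 (volume : Measure ℝ)] with t ht1 ht2 ht
  rw [ht2] at ht1
  simpa [ht] using ht1.symm

theorem IsEntireOfExpType.comp_neg {τ : ℝ} {f : ℂ → ℂ} (hf : IsEntireOfExpType τ f) :
    IsEntireOfExpType τ fun z => f (-z) := by
  refine ⟨hf.1.comp differentiable_neg, fun ε hε => ?_⟩
  obtain ⟨C, hC⟩ := hf.2 ε hε
  exact ⟨C, fun z => by simpa using hC (-z)⟩

/-- The support half of the Paley–Wiener theorem: the Fourier transform of an entire function of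
exponential type `2πh` that is square integrable on the line vanishes off `[-h, h]`. The half-line
`t > h` is reduced to `t < -h` by passing to `f (-z)`. -/
theorem fourier_ae_eq_zero_of_notMem_Icc {f : ℂ → ℂ} {h : ℝ} (hh : 0 ≤ h)
    (hf : IsEntireOfExpType (2 * Real.pi * h) f) (h2 : MemLp (fun x : ℝ => f x) 2) :
    ∀ᵐ t : ℝ, t ∉ Set.Icc (-h) h →
      (𝓕 (h2.toLp _) : Lp ℂ 2 (volume : Measure ℝ)) t = 0 := by
  have hτ : 0 ≤ 2 * Real.pi * h := by have := Real.pi_pos; positivity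
  have hsq : Integrable fun x : ℝ => ‖f x‖ ^ 2 :=
    (memLp_two_iff_integrable_sq_norm h2.1).1 h2
  have hsq' : Integrable fun x : ℝ => ‖f (-x)‖ ^ 2 := by
    have := hsq.comp_neg
    push_cast at this
    exact this
  have hn : ∀ n : ℕ, (1 : ℝ) ≤ n + 1 := fun n => by linarith [n.cast_nonneg (α := ℝ)]
  have hm : ∀ (s x : ℝ), ‖halfPlaneMollifier s x ^ 3‖ ≤ 1 := fun s x => by
    rw [norm_pow]
    exact pow_le_one₀ (norm_nonneg _) (norm_halfPlaneMollifier_ofReal_le_one _ _)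
  have hmt : ∀ x : ℝ, Tendsto (fun n : ℕ => halfPlaneMollifier (n + 1) x ^ 3) atTop (𝓝 1) :=
    fun x => by simpa using (tendsto_halfPlaneMollifier x).pow 3
  have hleft := fourier_ae_eq_zero_of_fourier_mul_eq_zero h2
    (m := fun n x => halfPlaneMollifier (n + 1) x ^ 3) (fun n x => hm _ x) hmt
    (fun n => integrable_mollified hτ hf hsq (hn n)) (measurableSet_Iio (a := -h))
    (fun n t ht => fourier_mollified_eq_zero hh hf hsq (hn n) ht)
  have hright := fourier_ae_eq_zero_of_fourier_mul_eq_zero h2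
    (m := fun n x => halfPlaneMollifier (n + 1) ((-x : ℝ) : ℂ) ^ 3) (fun n x => hm _ (-x))
    (fun x => hmt (-x))
    (fun n => by
      have := (integrable_mollified hτ hf.comp_neg hsq' (hn n)).comp_neg
      push_cast at this ⊢
      simpa using this)
    (measurableSet_Ioi (a := h))
    (fun n t ht => by
      have := fourier_mollified_eq_zero hh hf.comp_neg hsq' (hn n)
        (t := -t) (by simpa using ht)
      rw [← Real.fourierInv_eq_fourier_neg, Real.fourierInv_eq_fourier_comp_neg] at this
      push_cast at this ⊢
      simpa using this)
  filter_upwards [hleft, hright] with t h3 h4 ht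
  rw [Set.mem_Icc, not_and_or, not_le, not_le] at ht
  exact ht.elim h3 h4

/-! ### Paley–Wiener representation -/

/-- Entire functions that agree almost everywhere on the real line are equal. -/
theorem Differentiable.eq_of_ae_eq_ofReal {f g : ℂ → ℂ} (hf : Differentiable ℂ f)
    (hg : Differentiable ℂ g) (h : ∀ᵐ x : ℝ, f x = g x) : f = g := by
  have hreal : (fun x : ℝ => f x) = fun x : ℝ => g x :=
    Continuous.ae_eq_iff_eq (volume : Measure ℝ) (hf.continuous.comp Complex.continuous_ofReal)
      (hg.continuous.comp Complex.continuous_ofReal) |>.1 h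
  refine AnalyticOnNhd.eq_of_frequently_eq (𝕜 := ℂ) (z₀ := 0)
    (fun z _ => hf.analyticAt z) (fun z _ => hg.analyticAt z) ?_
  have hmap : Tendsto (fun x : ℝ => (x : ℂ)) (𝓝[≠] 0) (𝓝[≠] 0) := by
    refine tendsto_nhdsWithin_of_tendsto_nhds_of_eventually_within _ ?_ ?_
    · exact (Complex.continuous_ofReal.tendsto' 0 0 (by simp)).mono_left nhdsWithin_le_nhds
    · filter_upwards [self_mem_nhdsWithin] with x hx
      simpa using hx
  exact hmap.frequently (Eventually.frequently (Eventually.of_forall fun x => congrFun hreal x))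

/-- The function `z ↦ ∫_{-h}^{h} φ(t) e^{2πitz} dt` with spectrum `φ` on `[-h, h]`. Values of `φ`
outside `[-h, h]` play no role. -/
noncomputable def bandSynthesis (h : ℝ) (φ : ℝ → ℂ) (z : ℂ) : ℂ :=
  ∫ t in Set.Icc (-h) h, φ t * Complex.exp (2 * Real.pi * Complex.I * t * z)

theorem norm_exp_le_of_mem_Icc {h t : ℝ} (ht : t ∈ Set.Icc (-h) h) (z : ℂ) :
    ‖Complex.exp (2 * Real.pi * Complex.I * t * z)‖ ≤ Real.exp (2 * Real.pi * h * ‖z‖) := by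
  have := abs_le.2 ht
  refine (Complex.norm_exp_le_exp_norm _).trans (Real.exp_le_exp.2 ?_)
  simp only [norm_mul, Complex.norm_ofNat, Complex.norm_real, Complex.norm_I, Real.norm_eq_abs,
    abs_of_pos Real.pi_pos, mul_one]
  have := Real.pi_pos
  gcongr

theorem differentiable_bandSynthesis {h : ℝ} {φ : ℝ → ℂ} (hφ : IntegrableOn φ (Set.Icc (-h) h)) :
    Differentiable ℂ (bandSynthesis h φ) := by
  intro z₀
  have hmeas : ∀ z : ℂ, Continuous fun t : ℝ => Complex.exp (2 * Real.pi * Complex.I * t * z) :=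
    fun z => by fun_prop
  refine (hasDerivAt_integral_of_dominated_loc_of_deriv_le (μ := volume.restrict (Set.Icc (-h) h))
    (F := fun z t => φ t * Complex.exp (2 * Real.pi * Complex.I * t * z))
    (F' := fun z t => φ t * (Complex.exp (2 * Real.pi * Complex.I * t * z) *
      (2 * Real.pi * Complex.I * t)))
    (bound := fun t => ‖φ t‖ * (Real.exp (2 * Real.pi * h * (‖z₀‖ + 1)) * (2 * Real.pi * h)))
    (Metric.ball_mem_nhds z₀ one_pos) ?_ ?_ ?_ ?_ ?_ ?_).2.differentiableAt
  · exact Eventually.of_forall fun z => hφ.1.mul (hmeas z).aestronglyMeasurable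
  · refine hφ.mul_bdd (hmeas z₀).aestronglyMeasurable (c := Real.exp (2 * Real.pi * h * ‖z₀‖)) ?_
    exact (ae_restrict_iff' measurableSet_Icc).2 (Eventually.of_forall fun t ht =>
      norm_exp_le_of_mem_Icc ht z₀)
  · exact hφ.1.mul (by fun_prop)
  · refine (ae_restrict_iff' measurableSet_Icc).2 (Eventually.of_forall fun t ht z hz => ?_)
    have h1 := norm_exp_le_of_mem_Icc ht z
    have h2 := abs_le.2 ht
    have h3 : 0 ≤ h := (abs_nonneg t).trans h2
    have h4 : ‖z‖ ≤ ‖z₀‖ + 1 := by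
      have := norm_sub_norm_le z z₀
      rw [Metric.mem_ball, dist_eq_norm] at hz
      linarith
    have hpi := Real.pi_pos
    rw [norm_mul, norm_mul]
    have h5 : ‖(2 * Real.pi * Complex.I * t : ℂ)‖ = 2 * Real.pi * |t| := by
      simp [abs_of_pos hpi]
    rw [h5]
    gcongr
    exact h1.trans (by gcongr)
  · exact hφ.norm.mul_const _
  · refine Eventually.of_forall fun t z _ => ?_
    have := ((hasDerivAt_id z).const_mul (2 * Real.pi * Complex.I * t : ℂ)).cexp.const_mul (φ t)
    simpa using this

theorem norm_bandSynthesis_le {h : ℝ} {φ : ℝ → ℂ} (hφ : IntegrableOn φ (Set.Icc (-h) h)) (z : ℂ) :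
    ‖bandSynthesis h φ z‖ ≤ (∫ t in Set.Icc (-h) h, ‖φ t‖) * Real.exp (2 * Real.pi * h * ‖z‖) := by
  rw [← integral_mul_const]
  refine norm_integral_le_of_norm_le (hφ.norm.mul_const _) ?_
  refine (ae_restrict_iff' measurableSet_Icc).2 (Eventually.of_forall fun t ht => ?_)
  rw [norm_mul]
  gcongr
  exact norm_exp_le_of_mem_Icc ht z

theorem isEntireOfExpType_bandSynthesis {h : ℝ} {φ : ℝ → ℂ}
    (hφ : IntegrableOn φ (Set.Icc (-h) h)) :
    IsEntireOfExpType (2 * Real.pi * h) (bandSynthesis h φ) := by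
  refine ⟨differentiable_bandSynthesis hφ, fun ε hε => ⟨∫ t in Set.Icc (-h) h, ‖φ t‖, fun z =>
    (norm_bandSynthesis_le hφ z).trans ?_⟩⟩
  gcongr
  linarith

theorem bandSynthesis_ofReal (h : ℝ) (φ : ℝ → ℂ) (x : ℝ) :
    bandSynthesis h φ x = 𝓕⁻ ((Set.Icc (-h) h).indicator φ) x := by
  rw [bandSynthesis, Real.fourierInv_eq', ← integral_indicator measurableSet_Icc]
  refine integral_congr_ae (Eventually.of_forall fun t => ?_)
  simp only [Set.indicator_apply]
  split_ifs
  · simp only [RCLike.inner_apply, conj_trivial, smul_eq_mul]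
    rw [mul_comm]
    congr 2
    push_cast
    ring
  · simp

theorem Lp.integrableOn_Icc (φ : Lp ℂ 2 (volume : Measure ℝ)) (a b : ℝ) :
    IntegrableOn φ (Set.Icc a b) :=
  ((Lp.memLp φ).locallyIntegrable (by norm_num)).integrableOn_isCompact isCompact_Icc

theorem fourierInv_ae_eq_bandSynthesis {h : ℝ} {φ : Lp ℂ 2 (volume : Measure ℝ)}
    (hφ : ∀ᵐ t : ℝ, t ∉ Set.Icc (-h) h → φ t = 0) :
    (𝓕⁻ φ : Lp ℂ 2 (volume : Measure ℝ)) =ᵐ[volume] fun x : ℝ => bandSynthesis h φ x := by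
  have h2 := (Lp.memLp φ).indicator (measurableSet_Icc (a := -h) (b := h))
  have h1 : Integrable ((Set.Icc (-h) h).indicator φ) :=
    (Lp.integrableOn_Icc φ _ _).integrable_indicator measurableSet_Icc
  have e : φ = h2.toLp _ := by
    refine Lp.ext ?_
    filter_upwards [h2.coeFn_toLp, hφ] with t ht1 ht2
    rw [ht1]
    by_cases ht : t ∈ Set.Icc (-h) h
    · simp [ht]
    · simp [ht, ht2 ht]
  have := fourierInv_toLp_ae_eq h1 h2
  rw [← e] at this
  filter_upwards [this] with x hx
  rw [hx, bandSynthesis_ofReal]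

theorem memLp_bandSynthesis {h : ℝ} {φ : Lp ℂ 2 (volume : Measure ℝ)}
    (hφ : ∀ᵐ t : ℝ, t ∉ Set.Icc (-h) h → φ t = 0) :
    MemLp (fun x : ℝ => bandSynthesis h φ x) 2 :=
  (memLp_congr_ae (fourierInv_ae_eq_bandSynthesis hφ)).1 (Lp.memLp _)

/-- The Paley–Wiener theorem: an entire function of exponential type `2πh` that is square integrable
on the line is the band synthesis of the Fourier transform of its restriction to the line. -/
theorem eq_bandSynthesis_fourier {f : ℂ → ℂ} {h : ℝ} (hh : 0 ≤ h)
    (hf : IsEntireOfExpType (2 * Real.pi * h) f) (h2 : MemLp (fun x : ℝ => f x) 2) :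
    f = bandSynthesis h (𝓕 (h2.toLp _) : Lp ℂ 2 (volume : Measure ℝ)) := by
  refine hf.1.eq_of_ae_eq_ofReal (differentiable_bandSynthesis (Lp.integrableOn_Icc _ _ _)) ?_
  have := fourierInv_ae_eq_bandSynthesis (fourier_ae_eq_zero_of_notMem_Icc hh hf h2)
  rw [FourierTransform.fourierInv_fourier_eq] at this
  filter_upwards [this, h2.coeFn_toLp] with x h3 h4
  rw [← h3, h4]

/-! ### A trigonometric inequality -/

theorem mul_sin_add_cos_nonneg_of_le_pi {y : ℝ} (h0 : 0 ≤ y) (h : y ≤ Real.pi) :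
    0 ≤ y * Real.sin y + Real.cos y - 1 + 0.2999 * y ^ 2 := by
  have hp1 := Real.pi_gt_d4
  have hp2 := Real.pi_lt_d4
  have hpi : 2 / Real.pi ≤ 0.6368 := by rw [div_le_iff₀ Real.pi_pos]; linarith
  have hpi' : 0.6365 ≤ 2 / Real.pi := by rw [le_div_iff₀ Real.pi_pos]; linarith
  rcases le_total y (Real.pi / 2) with h1 | h1
  · have h2 := Real.one_sub_sq_div_two_le_cos (x := y)
    have h3 := Real.mul_le_sin h0 h1
    nlinarith [mul_le_mul_of_nonneg_left h3 h0, mul_nonneg h0 h0]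
  · have h2 := Real.mul_le_sin (x := Real.pi - y) (by linarith) (by linarith)
    rw [Real.sin_pi_sub, mul_sub, div_mul_cancel₀ _ Real.pi_pos.ne'] at h2
    have h3 := Real.neg_one_le_cos y
    have h4 := mul_le_mul_of_nonneg_left h2 h0
    have h5 : 2 / Real.pi * y * y ≤ 0.6368 * y * y := by gcongr
    nlinarith [mul_nonneg (sub_nonneg.2 h1) (sub_nonneg.2 h)]

theorem mul_sin_add_cos_nonneg_of_near_pi {v : ℝ} (h0 : 0 ≤ v) (h : v ≤ 0.8) :
    0 ≤ (Real.pi + v) * Real.sin (Real.pi + v) + Real.cos (Real.pi + v) - 1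
      + 0.2999 * (Real.pi + v) ^ 2 := by
  have hp1 := Real.pi_gt_d4
  have hp2 := Real.pi_lt_d4
  rw [add_comm Real.pi v, Real.sin_add_pi, Real.cos_add_pi]
  have hs := (abs_le.1 (Real.sin_bound (x := v) (by rw [abs_of_nonneg h0]; linarith))).2
  have hc := (abs_le.1 (Real.cos_bound (x := v) (by rw [abs_of_nonneg h0]; linarith))).2
  rw [abs_of_nonneg h0] at hs hc
  have hv2 : v ^ 2 ≤ 0.64 := by nlinarith
  have hs' : Real.sin v ≤ v - 0.16 * v ^ 3 := by
    nlinarith [mul_le_mul_of_nonneg_left hv2 (pow_nonneg h0 3)]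
  have hc' : Real.cos v ≤ 1 - 0.466 * v ^ 2 := by
    nlinarith [mul_le_mul_of_nonneg_left hv2 (pow_nonneg h0 2)]
  have h1 : (v + Real.pi) * Real.sin v ≤ (v + Real.pi) * (v - 0.16 * v ^ 3) := by gcongr
  have hv3 := pow_nonneg h0 3
  have hd : 0 ≤ (Real.pi - 3.1415) * (0.2999 * (Real.pi + 3.1415) + 0.5998 * v - v) :=
    mul_nonneg (by linarith) (by nlinarith)
  have hd2 : 0 ≤ (Real.pi - 3.1415) * v ^ 3 := mul_nonneg (by linarith) hv3
  have key : 0 ≤ 0.2999 * (3.1415 + v) ^ 2 - (3.1415 + v) * (v - 0.16 * v ^ 3) - 2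
      + 0.466 * v ^ 2 := by
    nlinarith [mul_nonneg h0 (sub_nonneg.2 h), mul_nonneg hv3 h0]
  nlinarith

theorem mul_sin_add_cos_nonneg_of_near_three_pi_div_two {u : ℝ} (h0 : 0.49 ≤ u) (h : u ≤ 0.79) :
    0 ≤ (3 * Real.pi / 2 - u) * Real.sin (3 * Real.pi / 2 - u) + Real.cos (3 * Real.pi / 2 - u) - 1
      + 0.2999 * (3 * Real.pi / 2 - u) ^ 2 := by
  have hp1 := Real.pi_gt_d4
  have hp2 := Real.pi_lt_d4
  have e : 3 * Real.pi / 2 - u = (Real.pi / 2 - u) + Real.pi := by ring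
  have hu0 : 0 ≤ u := by linarith
  have hs0 : Real.sin (3 * Real.pi / 2 - u) = -Real.cos u := by
    rw [e, Real.sin_add_pi, Real.sin_pi_div_two_sub]
  have hc0 : Real.cos (3 * Real.pi / 2 - u) = -Real.sin u := by
    rw [e, Real.cos_add_pi, Real.cos_pi_div_two_sub]
  rw [hs0, hc0]
  have hs := (abs_le.1 (Real.sin_bound (x := u) (by rw [abs_of_nonneg hu0]; linarith))).2
  have hc := (abs_le.1 (Real.cos_bound (x := u) (by rw [abs_of_nonneg hu0]; linarith))).2
  rw [abs_of_nonneg hu0] at hs hc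
  have hv2 : u ^ 2 ≤ 0.6241 := by nlinarith
  have hs' : Real.sin u ≤ u - 0.16 * u ^ 3 := by
    nlinarith [mul_le_mul_of_nonneg_left hv2 (pow_nonneg hu0 3), pow_nonneg hu0 3]
  have hc' : Real.cos u ≤ 1 - 0.467 * u ^ 2 := by
    nlinarith [mul_le_mul_of_nonneg_left hv2 (pow_nonneg hu0 2), pow_nonneg hu0 2]
  set q := 3 * Real.pi / 2 with hq
  have hq1 : 4.71225 ≤ q := by rw [hq]; linarith
  have h1 : (q - u) * Real.cos u ≤ (q - u) * (1 - 0.467 * u ^ 2) := by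
    have : 0 ≤ q - u := by linarith
    gcongr
  have hd : 0 ≤ (q - 4.71225) * (0.2999 * (q + 4.71225) - 0.5998 * u - 1) :=
    mul_nonneg (by linarith) (by nlinarith)
  have hd2 : 0 ≤ (q - 4.71225) * u ^ 2 := mul_nonneg (by linarith) (by positivity)
  have key : 0 ≤ 0.2999 * (4.71225 - u) ^ 2 - (4.71225 - u) * (1 - 0.467 * u ^ 2) -
      (u - 0.16 * u ^ 3) - 1 := by
    nlinarith [sq_nonneg (u - 0.63), mul_nonneg (sub_nonneg.2 h0) (sq_nonneg (u - 0.63)),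
      mul_nonneg (sub_nonneg.2 h) (sq_nonneg (u - 0.63))]
  nlinarith

/-- The inequality `y² ∫₀¹ t cos (yt) dt = y sin y + cos y - 1 ≥ -0.2999 y²`. The infimum of `∫₀¹
t cos (yt) dt` is about `-0.2934`, attained near `y = 4.08`; what matters is a constant below `3 /
10 = (1 / 2) / (5 / 3)`. Beyond `4.22` the bound `|y sin y + cos y| ≤ √(1 + y²)` suffices; up to
there `sin` and `cos` are compared with Taylor polynomials centred at `π` and `3π / 2`. -/
theorem mul_sin_add_cos_sub_one_add_nonneg (y : ℝ) :
    0 ≤ y * Real.sin y + Real.cos y - 1 + 0.2999 * y ^ 2 := by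
  wlog hy : 0 ≤ y generalizing y
  · simpa using this (-y) (by linarith)
  have hp1 := Real.pi_gt_d4
  have hp2 := Real.pi_lt_d4
  rcases le_total y Real.pi with h1 | h1
  · exact mul_sin_add_cos_nonneg_of_le_pi hy h1
  rcases le_total y (Real.pi + 0.8) with h2 | h2
  · simpa using mul_sin_add_cos_nonneg_of_near_pi (v := y - Real.pi) (by linarith) (by linarith)
  rcases le_total y 4.22 with h3 | h3
  · simpa using mul_sin_add_cos_nonneg_of_near_three_pi_div_two (u := 3 * Real.pi / 2 - y)
      (by linarith) (by linarith)
  have h4 : 0 ≤ 0.2999 * y ^ 2 - 1 := by nlinarith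
  have h5 : (y * Real.sin y + Real.cos y) ^ 2 ≤ (0.2999 * y ^ 2 - 1) ^ 2 := by
    have h6 : (y * Real.sin y + Real.cos y) ^ 2 ≤ 1 + y ^ 2 := by
      nlinarith [Real.sin_sq_add_cos_sq y, sq_nonneg (y * Real.cos y - Real.sin y)]
    have h7 : 17.8 ≤ y ^ 2 := by nlinarith
    nlinarith
  have := abs_le.1 (abs_le_of_sq_le_sq h5 h4)
  linarith [this.1]

/-! ### The weight -/

/-- The density `c₂ |α| 1_{[-Δ, Δ]}(α)` of the absolutely continuous part of `pairMeasure`, as a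
complex-valued function on the line. -/
noncomputable def pairDensity (Δ c₂ : ℝ) : ℝ → ℂ :=
  (Set.Icc (-Δ) Δ).indicator fun α => ((c₂ * |α| : ℝ) : ℂ)

theorem integrable_pairDensity (Δ c₂ : ℝ) : Integrable (pairDensity Δ c₂) := by
  refine IntegrableOn.integrable_indicator ?_ measurableSet_Icc
  exact Continuous.integrableOn_Icc (by fun_prop)

theorem norm_pairDensity_le {Δ c₂ : ℝ} (hΔ : 0 ≤ Δ) (hc₂ : 0 ≤ c₂) (α : ℝ) :
    ‖pairDensity Δ c₂ α‖ ≤ c₂ * Δ := by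
  rw [pairDensity, Set.indicator_apply]
  split_ifs with h
  · rw [Complex.norm_real, Real.norm_of_nonneg (by positivity)]
    gcongr
    exact abs_le.2 h
  · simp only [norm_zero]; positivity

theorem integral_pairMeasure {Δ c₁ c₂ : ℝ} (hc₁ : 0 ≤ c₁) (hc₂ : 0 ≤ c₂) {g : ℝ → ℂ}
    (hg : Continuous g) :
    ∫ α, g α ∂(pairMeasure Δ c₁ c₂) = c₁ * g 0 + ∫ α, pairDensity Δ c₂ α * g α := by
  have hm : Measurable fun α : ℝ => ENNReal.ofReal (c₂ * |α|) := by fun_prop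
  rw [pairMeasure, integral_add_measure]
  · congr 1
    · rw [integral_smul_measure, integral_dirac, ENNReal.toReal_ofReal hc₁]
      simp
    · rw [integral_withDensity_eq_integral_toReal_smul hm (by simp),
        ← integral_indicator measurableSet_Icc]
      refine integral_congr_ae (Eventually.of_forall fun α => ?_)
      simp only [pairDensity, Set.indicator_apply]
      split_ifs
      · rw [ENNReal.toReal_ofReal (by positivity)]
        simp
      · simp
  · exact (integrable_dirac (by simp)).smul_measure (by simp)
  · rw [integrable_withDensity_iff_integrable_smul' hm (by simp)]
    refine Continuous.integrableOn_Icc ?_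
    have : ∀ α : ℝ, (ENNReal.ofReal (c₂ * |α|)).toReal = c₂ * |α| := fun α =>
      ENNReal.toReal_ofReal (by positivity)
    simp_rw [this]
    fun_prop

theorem measureFourier_pairMeasure {Δ c₁ c₂ : ℝ} (hc₁ : 0 ≤ c₁) (hc₂ : 0 ≤ c₂) (x : ℝ) :
    measureFourier (pairMeasure Δ c₁ c₂) x = c₁ + 𝓕 (pairDensity Δ c₂) x := by
  rw [measureFourier, integral_pairMeasure hc₁ hc₂ (by fun_prop), Real.fourier_eq']
  congr 1
  · simp
  · refine integral_congr_ae (Eventually.of_forall fun t => ?_)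
    simp only [RCLike.inner_apply, conj_trivial, smul_eq_mul]
    rw [mul_comm]
    congr 2
    push_cast
    ring

theorem integral_mul_cos_eq (Δ : ℝ) {b : ℝ} (hb : b ≠ 0) :
    ∫ α in (0 : ℝ)..Δ, α * Real.cos (b * α)
      = Δ * Real.sin (b * Δ) / b + (Real.cos (b * Δ) - 1) / b ^ 2 := by
  rw [intervalIntegral.integral_eq_sub_of_hasDerivAt
    (f := fun α => α * Real.sin (b * α) / b + Real.cos (b * α) / b ^ 2)]
  · simp
    ring
  · intro α _
    have h1 : HasDerivAt (fun α : ℝ => b * α) b α := by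
      simpa using (hasDerivAt_id α).const_mul b
    have h2 := (((hasDerivAt_id α).mul h1.sin).div_const b).add (h1.cos.div_const (b ^ 2))
    refine h2.congr_deriv ?_
    rw [id]
    field_simp
    ring
  · exact Continuous.intervalIntegrable (by fun_prop) _ _

theorem neg_le_integral_mul_cos (Δ b : ℝ) :
    -0.2999 * Δ ^ 2 ≤ ∫ α in (0 : ℝ)..Δ, α * Real.cos (b * α) := by
  rcases eq_or_ne b 0 with rfl | hb
  · simp only [zero_mul, Real.cos_zero, mul_one, integral_id]
    nlinarith [sq_nonneg Δ]
  · rw [integral_mul_cos_eq Δ hb]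
    have h1 := mul_sin_add_cos_sub_one_add_nonneg (b * Δ)
    have hb2 : 0 < b ^ 2 := by positivity
    have h2 : Δ * Real.sin (b * Δ) / b + (Real.cos (b * Δ) - 1) / b ^ 2 - (-0.2999 * Δ ^ 2)
      = (b * Δ * Real.sin (b * Δ) + Real.cos (b * Δ) - 1 + 0.2999 * (b * Δ) ^ 2) / b ^ 2 := by
      field_simp
      ring
    have h3 := div_nonneg h1 hb2.le
    linarith

theorem fourier_pairDensity {Δ : ℝ} (hΔ : 0 ≤ Δ) (c₂ x : ℝ) :
    𝓕 (pairDensity Δ c₂) x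
      = ((2 * c₂ * ∫ α in (0 : ℝ)..Δ, α * Real.cos (2 * Real.pi * x * α) : ℝ) : ℂ) := by
  set g : ℝ → ℂ := fun α => ((c₂ * |α| : ℝ) : ℂ) * Complex.exp (-(2 * Real.pi * x * α) * Complex.I)
    with hg
  have hgc : Continuous g := by fun_prop
  have h1 : 𝓕 (pairDensity Δ c₂) x = ∫ α in (-Δ)..Δ, g α := by
    rw [intervalIntegral.integral_of_le (by linarith), ← integral_Icc_eq_integral_Ioc,
      ← integral_indicator measurableSet_Icc, Real.fourier_eq']
    refine integral_congr_ae (Eventually.of_forall fun t => ?_)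
    simp only [pairDensity, Set.indicator_apply, hg]
    split_ifs
    · simp only [RCLike.inner_apply, conj_trivial, smul_eq_mul]
      rw [mul_comm]
      congr 2
      push_cast
      ring
    · simp
  have hgn : Continuous fun α => g (-α) := hgc.comp continuous_neg
  have h2 : ∫ α in (-Δ)..0, g α = ∫ α in (0 : ℝ)..Δ, g (-α) := by
    rw [intervalIntegral.integral_comp_neg]
    simp
  rw [h1, ← intervalIntegral.integral_add_adjacent_intervals (b := 0)
    (hgc.intervalIntegrable _ _) (hgc.intervalIntegrable _ _), h2,
    ← intervalIntegral.integral_add (hgn.intervalIntegrable _ _)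
      (hgc.intervalIntegrable _ _), ← intervalIntegral.integral_const_mul,
    ← intervalIntegral.integral_ofReal]
  refine intervalIntegral.integral_congr fun α hα => ?_
  rw [Set.uIcc_of_le hΔ] at hα
  simp only [hg, abs_neg, abs_of_nonneg hα.1]
  push_cast
  rw [Complex.cos]
  have e1 : -(2 * Real.pi * x * -(α : ℂ)) * Complex.I = 2 * Real.pi * x * α * Complex.I := by ring
  rw [e1]
  ring

/-- The weight `ν̂(x) = c₁ + 2 c₂ ∫_0^Δ α cos(2πxα) dα` as a real number. -/
noncomputable def pairWeight (Δ c₁ c₂ x : ℝ) : ℝ :=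
  c₁ + 2 * c₂ * ∫ α in (0 : ℝ)..Δ, α * Real.cos (2 * Real.pi * x * α)

theorem ofReal_pairWeight {Δ : ℝ} (hΔ : 0 ≤ Δ) (c₁ c₂ x : ℝ) :
    ((pairWeight Δ c₁ c₂ x : ℝ) : ℂ) = c₁ + 𝓕 (pairDensity Δ c₂) x := by
  rw [fourier_pairDensity hΔ, pairWeight]
  push_cast
  rfl

theorem measureFourier_eq_pairWeight {Δ c₁ c₂ : ℝ} (hΔ : 0 ≤ Δ) (hc₁ : 0 ≤ c₁) (hc₂ : 0 ≤ c₂)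
    (x : ℝ) : measureFourier (pairMeasure Δ c₁ c₂) x = pairWeight Δ c₁ c₂ x := by
  rw [measureFourier_pairMeasure hc₁ hc₂, ofReal_pairWeight hΔ]

theorem continuous_pairWeight {Δ : ℝ} (hΔ : 0 ≤ Δ) (c₁ c₂ : ℝ) :
    Continuous (pairWeight Δ c₁ c₂) := by
  have : Continuous fun x => ((pairWeight Δ c₁ c₂ x : ℝ) : ℂ) := by
    simp_rw [ofReal_pairWeight hΔ]
    exact continuous_const.add (continuous_fourier (integrable_pairDensity Δ c₂))
  exact Complex.continuous_re.comp this

theorem exists_abs_pairWeight_le {Δ : ℝ} (hΔ : 0 ≤ Δ) (c₁ c₂ : ℝ) :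
    ∃ C, ∀ x, |pairWeight Δ c₁ c₂ x| ≤ C := by
  refine ⟨|c₁| + ∫ α, ‖pairDensity Δ c₂ α‖, fun x => ?_⟩
  have := congrArg norm (ofReal_pairWeight hΔ c₁ c₂ x)
  rw [Complex.norm_real, Real.norm_eq_abs] at this
  rw [this]
  refine (norm_add_le _ _).trans (add_le_add (by simp) ?_)
  exact VectorFourier.norm_fourierIntegral_le_integral_norm _ _ _ _ _

/-- The weight is bounded away from zero. This is where `c₂ Δ² / c₁ ≤ 5 / 3` is used:
`1 - 2 · 0.2999 · 5 / 3 = 1 / 3000`. -/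
theorem pairWeight_lower_bound {Δ c₁ c₂ : ℝ} (hc₁ : 0 < c₁) (hc₂ : 0 ≤ c₂)
    (h : c₂ / c₁ * Δ ^ 2 ≤ 5 / 3) (x : ℝ) : c₁ / 3000 ≤ pairWeight Δ c₁ c₂ x := by
  have h1 := neg_le_integral_mul_cos Δ (2 * Real.pi * x)
  have h2 : c₂ * Δ ^ 2 ≤ 5 / 3 * c₁ := by
    rw [div_mul_eq_mul_div, div_le_iff₀ hc₁] at h
    exact h
  have h3 := mul_le_mul_of_nonneg_left h1 hc₂
  rw [pairWeight]
  nlinarith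

/-! ### Coercivity and representation in `L²` -/

/-- Multiplication by the essentially bounded function `m`, as an operator on `L²(ℝ)`. -/
noncomputable def mulL2 {m : ℝ → ℂ} (hm : MemLp m ∞) :
    Lp ℂ 2 (volume : Measure ℝ) →L[ℂ] Lp ℂ 2 (volume : Measure ℝ) :=
  (ContinuousLinearMap.mul ℂ ℂ).holderL volume ∞ 2 2 (hm.toLp m)

theorem coeFn_mulL2 {m : ℝ → ℂ} (hm : MemLp m ∞) (φ : Lp ℂ 2 (volume : Measure ℝ)) :
    mulL2 hm φ =ᵐ[volume] fun x => m x * φ x := by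
  filter_upwards [(ContinuousLinearMap.mul ℂ ℂ).coeFn_holder (r := 2) (hm.toLp m) φ,
    hm.coeFn_toLp] with x h1 h2
  rw [← h2]
  exact h1

theorem memLp_top_indicator_one (s : Set ℝ) (hs : MeasurableSet s) :
    MemLp (s.indicator fun _ => (1 : ℂ)) ∞ (volume : Measure ℝ) :=
  (memLp_top_const 1).indicator hs

/-- The orthogonal projection of `L²(ℝ)` onto the functions supported in `[-h, h]`: multiplication
by the indicator function of that interval. -/
noncomputable def bandProj (h : ℝ) :
    Lp ℂ 2 (volume : Measure ℝ) →L[ℂ] Lp ℂ 2 (volume : Measure ℝ) :=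
  mulL2 (memLp_top_indicator_one (Set.Icc (-h) h) measurableSet_Icc)

theorem coeFn_bandProj (h : ℝ) (φ : Lp ℂ 2 (volume : Measure ℝ)) :
    bandProj h φ =ᵐ[volume] (Set.Icc (-h) h).indicator φ := by
  filter_upwards [coeFn_mulL2 (memLp_top_indicator_one (Set.Icc (-h) h) measurableSet_Icc) φ]
    with t ht
  rw [bandProj, ht]
  by_cases h1 : t ∈ Set.Icc (-h) h <;> simp [h1]

theorem bandProj_eq_self_iff {h : ℝ} {φ : Lp ℂ 2 (volume : Measure ℝ)} :
    bandProj h φ = φ ↔ ∀ᵐ t : ℝ, t ∉ Set.Icc (-h) h → φ t = 0 := by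
  constructor
  · intro h1
    have := coeFn_bandProj h φ
    rw [h1] at this
    filter_upwards [this] with t ht ht'
    rw [ht, Set.indicator_of_notMem ht']
  · intro h1
    refine Lp.ext ?_
    filter_upwards [coeFn_bandProj h φ, h1] with t ht ht'
    rw [ht]
    by_cases h2 : t ∈ Set.Icc (-h) h
    · simp [h2]
    · simp [h2, ht' h2]

theorem bandProj_bandProj (h : ℝ) (φ : Lp ℂ 2 (volume : Measure ℝ)) :
    bandProj h (bandProj h φ) = bandProj h φ := by
  rw [bandProj_eq_self_iff]
  filter_upwards [coeFn_bandProj h φ] with t ht ht'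
  rw [ht, Set.indicator_of_notMem ht']

theorem inner_bandProj_left (h : ℝ) (φ χ : Lp ℂ 2 (volume : Measure ℝ)) :
    ⟪bandProj h φ, χ⟫ = ⟪φ, bandProj h χ⟫ := by
  rw [L2.inner_def, L2.inner_def]
  refine integral_congr_ae ?_
  filter_upwards [coeFn_bandProj h φ, coeFn_bandProj h χ] with t h1 h2
  rw [h1, h2]
  by_cases h3 : t ∈ Set.Icc (-h) h <;> simp [h3]

theorem inner_bandProj_self (h : ℝ) (φ : Lp ℂ 2 (volume : Measure ℝ)) :
    ⟪bandProj h φ, φ⟫ = ((‖bandProj h φ‖ ^ 2 : ℝ) : ℂ) := by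
  rw [← bandProj_bandProj, inner_bandProj_left, bandProj_bandProj, inner_self_eq_norm_sq_to_K]
  norm_cast

theorem norm_bandProj_le (h : ℝ) (φ : Lp ℂ 2 (volume : Measure ℝ)) :
    ‖bandProj h φ‖ ≤ ‖φ‖ := by
  have h1 := norm_inner_le_norm (𝕜 := ℂ) (bandProj h φ) φ
  rw [inner_bandProj_self, Complex.norm_real, Real.norm_of_nonneg (by positivity)] at h1
  by_contra! h2
  have h3 : 0 < ‖bandProj h φ‖ := (norm_nonneg _).trans_lt h2
  nlinarith

/-- Multiplication by a real function that is at least `δ` is coercive with constant `δ`. -/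
theorem le_re_inner_mulL2 {W : ℝ → ℝ} (hm : MemLp (fun x => (W x : ℂ)) ∞) {δ : ℝ}
    (hδ : ∀ x, δ ≤ W x) (φ : Lp ℂ 2 (volume : Measure ℝ)) :
    δ * ‖φ‖ ^ 2 ≤ (⟪mulL2 hm φ, φ⟫).re := by
  have h1 : ⟪φ, φ⟫ = ((‖φ‖ ^ 2 : ℝ) : ℂ) := by
    rw [inner_self_eq_norm_sq_to_K]
    norm_cast
  have hint1 : Integrable fun x => ‖φ x‖ ^ 2 :=
    (memLp_two_iff_integrable_sq_norm (Lp.aestronglyMeasurable φ)).1 (Lp.memLp φ)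
  have e1 : ‖φ‖ ^ 2 = ∫ x, ‖φ x‖ ^ 2 := by
    have := congrArg Complex.re h1
    rw [Complex.ofReal_re] at this
    rw [← this, L2.inner_def, ← RCLike.re_eq_complex_re, ← integral_re (L2.integrable_inner φ φ)]
    refine integral_congr_ae (Eventually.of_forall fun x => ?_)
    simp only [RCLike.inner_apply, RCLike.mul_conj]
    norm_cast
  have hpt : ∀ᵐ x : ℝ, RCLike.re (⟪mulL2 hm φ x, φ x⟫) = W x * ‖φ x‖ ^ 2 := by
    filter_upwards [coeFn_mulL2 hm φ] with x hx
    rw [hx, RCLike.inner_apply, map_mul (starRingEnd ℂ), Complex.conj_ofReal, mul_left_comm,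
      RCLike.mul_conj, RCLike.re_eq_complex_re, Complex.re_ofReal_mul]
    norm_cast
  have hint2 : Integrable fun x => W x * ‖φ x‖ ^ 2 :=
    ((L2.integrable_inner (𝕜 := ℂ) (mulL2 hm φ) φ).re).congr hpt
  have e2 : (⟪mulL2 hm φ, φ⟫).re = ∫ x, W x * ‖φ x‖ ^ 2 := by
    rw [L2.inner_def, ← RCLike.re_eq_complex_re, ← integral_re (L2.integrable_inner _ φ)]
    exact integral_congr_ae hpt
  rw [e1, e2, ← integral_const_mul]
  refine integral_mono (hint1.const_mul _) hint2 fun x => ?_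
  exact mul_le_mul_of_nonneg_right (hδ x) (by positivity)

/-- Riesz representation for the weighted inner product `⟪W 𝓕⁻ψ, 𝓕⁻φ⟫` on the spectra supported in
`[-h, h]`: every functional `⟪e, ·⟫` is represented by some `ψ`. -/
theorem exists_bandProj_representer {W : ℝ → ℝ} (hm : MemLp (fun x => (W x : ℂ)) ∞) {δ : ℝ}
    (hδ0 : 0 < δ) (hδ : ∀ x, δ ≤ W x) (h : ℝ) {e : Lp ℂ 2 (volume : Measure ℝ)}
    (he : bandProj h e = e) :
    ∃ ψ : Lp ℂ 2 (volume : Measure ℝ), bandProj h ψ = ψ ∧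
      ∀ φ : Lp ℂ 2 (volume : Measure ℝ), bandProj h φ = φ →
        ⟪mulL2 hm (𝓕⁻ ψ), (𝓕⁻ φ : Lp ℂ 2 (volume : Measure ℝ))⟫ = ⟪e, φ⟫ := by
  set F := Lp.fourierTransformₗᵢ ℝ ℂ
  have hF : ∀ a b : Lp ℂ 2 (volume : Measure ℝ), ⟪F a, b⟫ = ⟪a, F.symm b⟫ := fun a b => by
    rw [← F.inner_map_map a (F.symm b), F.apply_symm_apply]
  set P := bandProj h
  -- The compressed operator `P 𝓕 W 𝓕⁻ P` is completed by the identity on the orthogonal complement,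
  -- so that it is coercive, hence invertible, on all of `L²(ℝ)`.
  let S : Lp ℂ 2 (volume : Measure ℝ) →L[ℂ] Lp ℂ 2 (volume : Measure ℝ) :=
    P ∘L (F : Lp ℂ 2 (volume : Measure ℝ) →L[ℂ] Lp ℂ 2 (volume : Measure ℝ)) ∘L mulL2 hm ∘L
      (F.symm : Lp ℂ 2 (volume : Measure ℝ) →L[ℂ] Lp ℂ 2 (volume : Measure ℝ)) ∘L P + (1 - P)
  have hS : ∀ φ, S φ = P (F (mulL2 hm (F.symm (P φ)))) + (φ - P φ) := fun φ => rfl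
  -- On the complement the constant is `1`, hence the minimum.
  set d := min δ 1
  have hd : 0 < d := lt_min hδ0 one_pos
  have hcoer : ∀ φ, d * ‖φ‖ ^ 2 ≤ (⟪S φ, φ⟫).re := by
    intro φ
    have h1 := le_re_inner_mulL2 hm (fun x => (min_le_left δ 1).trans (hδ x)) (F.symm (P φ))
    rw [LinearIsometryEquiv.norm_map] at h1
    have h2 : ⟪φ, φ⟫ = ((‖φ‖ ^ 2 : ℝ) : ℂ) := by
      rw [inner_self_eq_norm_sq_to_K]
      norm_cast
    rw [hS, inner_add_left, inner_sub_left, inner_bandProj_left, hF, inner_bandProj_self, h2,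
      Complex.add_re, Complex.sub_re, Complex.ofReal_re, Complex.ofReal_re]
    have h3 := pow_le_pow_left₀ (norm_nonneg _) (norm_bandProj_le h φ) 2
    have h4 : d ≤ 1 := min_le_right _ _
    nlinarith
  have hunit : IsUnit S := by
    refine ContinuousLinearMap.isUnit_of_forall_le_norm_inner_map S (c := ⟨d, hd.le⟩) hd fun φ => ?_
    rw [mul_comm]
    exact (hcoer φ).trans (Complex.re_le_norm _)
  obtain ⟨ψ, hψ⟩ := ((ContinuousLinearMap.isUnit_iff_bijective).1 hunit).2 e
  have hPψ : P ψ = ψ := by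
    have h1 := congrArg P hψ
    rw [hS, he, map_add, map_sub, bandProj_bandProj, bandProj_bandProj, sub_self, add_zero,
      ← hψ, hS] at h1
    exact (sub_eq_zero.1 (left_eq_add.1 h1)).symm
  refine ⟨ψ, hPψ, fun φ hφ => ?_⟩
  rw [hS, hPψ, sub_self, add_zero] at hψ
  rw [← hψ, inner_bandProj_left, hφ, hF]
  rfl

/-! ### Multiplication by the weight as a convolution -/

theorem memLp_two_of_integrable_of_bound {g : ℝ → ℂ} (hg : Integrable g) {C : ℝ}
    (hC : ∀ x, ‖g x‖ ≤ C) : MemLp g 2 := by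
  rw [memLp_two_iff_integrable_sq_norm hg.1]
  refine (hg.norm.const_mul C).mono' (hg.1.norm.pow 2) (Eventually.of_forall fun x => ?_)
  rw [Real.norm_of_nonneg (by positivity), sq]
  exact mul_le_mul_of_nonneg_right (hC x) (norm_nonneg _)

theorem pairWeight_neg (Δ c₁ c₂ x : ℝ) : pairWeight Δ c₁ c₂ (-x) = pairWeight Δ c₁ c₂ x := by
  simp only [pairWeight]
  congr 3
  ext α
  rw [show 2 * Real.pi * -x * α = -(2 * Real.pi * x * α) by ring, Real.cos_neg]

/-- On the Fourier side, multiplication by the weight is convolution with the measure, split into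
its atom and its density. The weight is even, so `𝓕⁻` may take the place of `𝓕`. -/
theorem fourierInv_add_convolution_pairDensity {Δ : ℝ} (hΔ : 0 ≤ Δ) (c₁ c₂ : ℝ) {g : ℝ → ℂ}
    (hg : Integrable g) (x : ℝ) :
    𝓕⁻ (fun s => c₁ * g s + (g ⋆[ContinuousLinearMap.mul ℂ ℂ] pairDensity Δ c₂) s) x
      = pairWeight Δ c₁ c₂ x * 𝓕⁻ g x := by
  have hk := integrable_pairDensity Δ c₂
  have h1 : 𝓕 (fun s => c₁ * g s + (g ⋆[ContinuousLinearMap.mul ℂ ℂ] pairDensity Δ c₂) s) (-x)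
      = c₁ * 𝓕 g (-x) + 𝓕 (g ⋆[ContinuousLinearMap.mul ℂ ℂ] pairDensity Δ c₂) (-x) := by
    have i1 := (Real.fourierIntegral_convergent_iff (-x)).2 (hg.const_mul (c₁ : ℂ))
    have i2 := (Real.fourierIntegral_convergent_iff (-x)).2
      (hg.integrable_convolution (ContinuousLinearMap.mul ℂ ℂ) hk)
    simp_rw [Real.fourier_eq, smul_add]
    rw [integral_add i1 i2, ← integral_const_mul]
    simp only [Circle.smul_def, smul_eq_mul, mul_left_comm]
  rw [Real.fourierInv_eq_fourier_neg, Real.fourierInv_eq_fourier_neg, h1,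
    Real.fourier_mul_convolution_eq hg hk, ← pairWeight_neg, ofReal_pairWeight hΔ]
  ring

theorem norm_convolution_pairDensity_le {Δ c₂ : ℝ} (hΔ : 0 ≤ Δ) (hc₂ : 0 ≤ c₂) {g : ℝ → ℂ}
    (hg : Integrable g) (s : ℝ) :
    ‖(g ⋆[ContinuousLinearMap.mul ℂ ℂ] pairDensity Δ c₂) s‖ ≤ (∫ t, ‖g t‖) * (c₂ * Δ) := by
  rw [convolution_def, ← integral_mul_const]
  refine norm_integral_le_of_norm_le (hg.norm.mul_const _) (Eventually.of_forall fun t => ?_)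
  rw [ContinuousLinearMap.mul_apply', norm_mul]
  gcongr
  exact norm_pairDensity_le hΔ hc₂ _

/-- For `s` and `t` in `[-h, h]` the difference `s - t` stays in `[-2h, 2h]`, so the truncation of
the density is invisible. -/
theorem convolution_pairDensity_of_mem_Icc {h : ℝ} (c₂ : ℝ) (u : ℝ → ℝ) {s : ℝ}
    (hs : s ∈ Set.Icc (-h) h) :
    ((Set.Icc (-h) h).indicator (fun t => (u t : ℂ)) ⋆[ContinuousLinearMap.mul ℂ ℂ]
      pairDensity (2 * h) c₂) s = ((c₂ * ∫ t in (-h)..h, |s - t| * u t : ℝ) : ℂ) := by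
  have hh : -h ≤ h := hs.1.trans hs.2
  rw [convolution_def, intervalIntegral.integral_of_le hh, ← integral_Icc_eq_integral_Ioc,
    ← integral_const_mul, ← integral_complex_ofReal, ← integral_indicator measurableSet_Icc]
  refine integral_congr_ae (Eventually.of_forall fun t => ?_)
  by_cases ht : t ∈ Set.Icc (-h) h
  · have hst : s - t ∈ Set.Icc (-(2 * h)) (2 * h) := by
      constructor <;> linarith [hs.1, hs.2, ht.1, ht.2]
    simp only [ContinuousLinearMap.mul_apply', pairDensity, Set.indicator_of_mem ht,
      Set.indicator_of_mem hst]
    push_cast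
    ring
  · simp [ht]

theorem weightedInner_eq_inner_mulL2 {ν : Measure ℝ} {W : ℝ → ℝ}
    (hν : ∀ x, measureFourier ν x = W x) (hm : MemLp (fun x => (W x : ℂ)) ∞) {f g : ℂ → ℂ}
    (hf : MemLp (fun x : ℝ => f x) 2) (hg : MemLp (fun x : ℝ => g x) 2) :
    weightedInner ν f g = ⟪mulL2 hm (hg.toLp _), hf.toLp _⟫ := by
  rw [weightedInner, L2.inner_def]
  refine integral_congr_ae ?_
  filter_upwards [coeFn_mulL2 hm (hg.toLp _), hf.coeFn_toLp, hg.coeFn_toLp] with x h1 h2 h3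
  rw [h1, h2, h3, hν, RCLike.inner_apply, map_mul, Complex.conj_ofReal]
  ring

theorem exists_norm_indicator_Icc_le {u : ℝ → ℂ} (hu : Continuous u) (a b : ℝ) :
    ∃ B, ∀ t, ‖(Set.Icc a b).indicator u t‖ ≤ B := by
  obtain ⟨B, hB⟩ := isCompact_Icc.exists_bound_of_continuousOn (s := Set.Icc a b) hu.continuousOn
  refine ⟨max B 0, fun t => ?_⟩
  by_cases ht : t ∈ Set.Icc a b
  · rw [Set.indicator_of_mem ht]
    exact (hB t ht).trans (le_max_left _ _)
  · rw [Set.indicator_of_notMem ht, norm_zero]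
    exact le_max_right _ _

theorem integrable_indicator_Icc {u : ℝ → ℂ} (hu : Continuous u) (a b : ℝ) :
    Integrable ((Set.Icc a b).indicator u) :=
  hu.integrableOn_Icc.integrable_indicator measurableSet_Icc

theorem memLp_indicator_Icc {u : ℝ → ℂ} (hu : Continuous u) (a b : ℝ) :
    MemLp ((Set.Icc a b).indicator u) 2 := by
  obtain ⟨B, hB⟩ := exists_norm_indicator_Icc_le hu a b
  exact memLp_two_of_integrable_of_bound (integrable_indicator_Icc hu a b) hB

theorem fourierInv_indicator_ae_eq_bandSynthesis {u : ℝ → ℂ} (hu : Continuous u) (h : ℝ) :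
    (𝓕⁻ ((memLp_indicator_Icc hu (-h) h).toLp _) : Lp ℂ 2 (volume : Measure ℝ)) =ᵐ[volume]
      fun x : ℝ => bandSynthesis h u x := by
  filter_upwards [fourierInv_toLp_ae_eq (integrable_indicator_Icc hu (-h) h)
    (memLp_indicator_Icc hu (-h) h)] with x hx
  rw [hx, bandSynthesis_ofReal]

theorem memLp_bandSynthesis_of_continuous {u : ℝ → ℂ} (hu : Continuous u) (h : ℝ) :
    MemLp (fun x : ℝ => bandSynthesis h u x) 2 :=
  (memLp_congr_ae (fourierInv_indicator_ae_eq_bandSynthesis hu h)).1 (Lp.memLp _)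

/-- If the profile `u` solves `c₁ u(s) + c₂ ∫_{-h}^{h} |s - t| u(t) dt = 1` on `[-h, h]`, then the
function with spectrum `u` represents evaluation at `0`. -/
theorem weightedInner_bandSynthesis_eq_apply_zero {h c₁ c₂ : ℝ} (hh : 0 ≤ h) (hc₁ : 0 ≤ c₁)
    (hc₂ : 0 ≤ c₂) {u : ℝ → ℝ} (hu : Continuous u)
    (heq : ∀ s ∈ Set.Icc (-h) h, c₁ * u s + c₂ * ∫ t in (-h)..h, |s - t| * u t = 1)
    (hm : MemLp (fun x => (pairWeight (2 * h) c₁ c₂ x : ℂ)) ∞)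
    {f : ℂ → ℂ} (hf : IsEntireOfExpType (2 * Real.pi * h) f) (h2 : MemLp (fun x : ℝ => f x) 2) :
    f 0 = weightedInner (pairMeasure (2 * h) c₁ c₂) f (bandSynthesis h fun t => (u t : ℂ)) := by
  have hΔ : 0 ≤ 2 * h := by linarith
  set ψ : ℝ → ℂ := (Set.Icc (-h) h).indicator fun t => (u t : ℂ) with hψ
  have huc : Continuous fun t => (u t : ℂ) := by fun_prop
  have hψ1 : Integrable ψ := integrable_indicator_Icc huc (-h) h
  have hψ2 : MemLp ψ 2 := memLp_indicator_Icc huc (-h) h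
  obtain ⟨B, hB⟩ := exists_norm_indicator_Icc_le huc (-h) h
  -- `Γ` is the spectrum of the weight times the band synthesis; it equals `1` on `[-h, h]`.
  set Γ : ℝ → ℂ := fun s =>
    c₁ * ψ s + (ψ ⋆[ContinuousLinearMap.mul ℂ ℂ] pairDensity (2 * h) c₂) s with hΓ
  have hΓ1 : Integrable Γ := (hψ1.const_mul _).add
    (hψ1.integrable_convolution (ContinuousLinearMap.mul ℂ ℂ) (integrable_pairDensity _ _))
  have hΓ2 : MemLp Γ 2 := by
    refine memLp_two_of_integrable_of_bound hΓ1
      (C := c₁ * B + (∫ t, ‖ψ t‖) * (c₂ * (2 * h))) fun s => ?_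
    refine (norm_add_le _ _).trans (add_le_add ?_ (norm_convolution_pairDensity_le hΔ hc₂ hψ1 s))
    rw [norm_mul, Complex.norm_real, Real.norm_of_nonneg hc₁]
    exact mul_le_mul_of_nonneg_left (hB s) hc₁
  have hsyn := fourierInv_indicator_ae_eq_bandSynthesis huc h
  have hsyn2 := memLp_bandSynthesis_of_continuous huc h
  have hsyn3 : hsyn2.toLp _ = 𝓕⁻ (hψ2.toLp ψ) := by
    refine Lp.ext ?_
    filter_upwards [hsyn2.coeFn_toLp, hsyn] with x h3 h4
    rw [h3, h4]
  have hmul : mulL2 hm (𝓕⁻ (hψ2.toLp ψ)) = 𝓕⁻ (hΓ2.toLp Γ) := by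
    refine Lp.ext ?_
    filter_upwards [coeFn_mulL2 hm (𝓕⁻ (hψ2.toLp ψ)), fourierInv_toLp_ae_eq hψ1 hψ2,
      fourierInv_toLp_ae_eq hΓ1 hΓ2] with x h3 h4 h5
    rw [h3, h4, h5, hΓ, fourierInv_add_convolution_pairDensity hΔ c₁ c₂ hψ1]
  rw [weightedInner_eq_inner_mulL2 (measureFourier_eq_pairWeight hΔ hc₁ hc₂) hm h2 hsyn2, hsyn3,
    hmul, ← Lp.inner_fourier_eq, FourierTransform.fourier_fourierInv_eq, L2.inner_def]
  have hf0 := congrFun (eq_bandSynthesis_fourier hh hf h2) 0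
  rw [hf0, bandSynthesis, ← integral_indicator measurableSet_Icc]
  refine integral_congr_ae ?_
  filter_upwards [hΓ2.coeFn_toLp, fourier_ae_eq_zero_of_notMem_Icc hh hf h2] with t h3 h4
  by_cases ht : t ∈ Set.Icc (-h) h
  · have h5 : Γ t = 1 := by
      simp only [hΓ]
      rw [convolution_pairDensity_of_mem_Icc c₂ u ht, hψ, Set.indicator_of_mem ht]
      exact_mod_cast heq t ht
    rw [h3, h5, Set.indicator_of_mem ht]
    simp
  · rw [h4 ht, Set.indicator_of_notMem ht]
    simp

/-! ### Existence and uniqueness of reproducing elements -/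

theorem IsEntireOfExpType.sub {τ : ℝ} {f g : ℂ → ℂ} (hf : IsEntireOfExpType τ f)
    (hg : IsEntireOfExpType τ g) : IsEntireOfExpType τ fun z => f z - g z := by
  refine ⟨hf.1.sub hg.1, fun ε hε => ?_⟩
  obtain ⟨A, hA⟩ := hf.2 ε hε
  obtain ⟨B, hB⟩ := hg.2 ε hε
  refine ⟨A + B, fun z => (norm_sub_le _ _).trans ?_⟩
  rw [add_mul]
  exact add_le_add (hA z) (hB z)

theorem memLp_top_ofReal {W : ℝ → ℝ} (hW : Continuous W) {C : ℝ} (hC : ∀ x, |W x| ≤ C) :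
    MemLp (fun x => (W x : ℂ)) ∞ (volume : Measure ℝ) :=
  memLp_top_of_bound (by fun_prop) C (Eventually.of_forall fun x => by
    simpa using hC x)

/-- A weight between two positive constants does not change the square integrability condition. -/
theorem mem_weightedSpace_iff {Δ : ℝ} {ν : Measure ℝ} {W : ℝ → ℝ}
    (hν : ∀ x, measureFourier ν x = W x) (hW : Continuous W) {C : ℝ} (hC : ∀ x, |W x| ≤ C)
    {δ : ℝ} (hδ0 : 0 < δ) (hδ : ∀ x, δ ≤ W x) {f : ℂ → ℂ} :
    f ∈ weightedSpace Δ ν ↔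
      IsEntireOfExpType (Real.pi * Δ) f ∧ MemLp (fun x : ℝ => f x) 2 := by
  rw [weightedSpace, Set.mem_ofPred_eq]
  refine and_congr_right fun hf => ?_
  have hcont : Continuous fun x : ℝ => f x := hf.1.continuous.comp Complex.continuous_ofReal
  rw [memLp_two_iff_integrable_sq_norm hcont.aestronglyMeasurable]
  simp_rw [hν]
  constructor
  · intro h1
    refine (h1.norm.const_mul δ⁻¹).mono' (hcont.norm.pow 2).aestronglyMeasurable
      (Eventually.of_forall fun x => ?_)
    rw [Real.norm_of_nonneg (by positivity), norm_mul, Complex.norm_real, Complex.norm_real,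
      Real.norm_of_nonneg (by positivity), Real.norm_of_nonneg (hδ0.le.trans (hδ x)),
      le_inv_mul_iff₀ hδ0, mul_comm δ]
    exact mul_le_mul_of_nonneg_left (hδ x) (by positivity)
  · intro h1
    refine Integrable.mul_bdd (c := C) h1.ofReal (by fun_prop) (Eventually.of_forall fun x => ?_)
    simpa using hC x

/-- Evaluation at `w` is the pairing of the spectrum with `conj e^{2πitw}` on `[-h, h]`, hence it is
represented in the weighted inner product. -/
theorem exists_reproducing_element {h : ℝ} (hh : 0 ≤ h) {ν : Measure ℝ} {W : ℝ → ℝ}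
    (hν : ∀ x, measureFourier ν x = W x) (hm : MemLp (fun x => (W x : ℂ)) ∞)
    {δ : ℝ} (hδ0 : 0 < δ) (hδ : ∀ x, δ ≤ W x) (w : ℂ) :
    ∃ k : ℂ → ℂ, IsEntireOfExpType (2 * Real.pi * h) k ∧ MemLp (fun x : ℝ => k x) 2 ∧
      ∀ f : ℂ → ℂ, IsEntireOfExpType (2 * Real.pi * h) f → MemLp (fun x : ℝ => f x) 2 →
        f w = weightedInner ν f k := by
  set E : ℝ → ℂ := (Set.Icc (-h) h).indicator fun t =>
    (starRingEnd ℂ) (Complex.exp (2 * Real.pi * Complex.I * t * w)) with hE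
  have hE1 : Integrable E := by
    refine IntegrableOn.integrable_indicator ?_ measurableSet_Icc
    refine Continuous.integrableOn_Icc ?_
    exact Complex.continuous_conj.comp (by fun_prop)
  have hE2 : MemLp E 2 := by
    refine memLp_two_of_integrable_of_bound hE1 (C := Real.exp (2 * Real.pi * h * ‖w‖)) fun t => ?_
    by_cases ht : t ∈ Set.Icc (-h) h
    · rw [hE, Set.indicator_of_mem ht, RCLike.norm_conj]
      exact norm_exp_le_of_mem_Icc ht w
    · rw [hE, Set.indicator_of_notMem ht, norm_zero]
      positivity
  have he : bandProj h (hE2.toLp E) = hE2.toLp E := by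
    rw [bandProj_eq_self_iff]
    filter_upwards [hE2.coeFn_toLp] with t ht ht'
    rw [ht, hE, Set.indicator_of_notMem ht']
  obtain ⟨ψ, hψ, hrep⟩ := exists_bandProj_representer hm hδ0 hδ h he
  rw [bandProj_eq_self_iff] at hψ
  have hk2 := memLp_bandSynthesis hψ
  refine ⟨bandSynthesis h ψ, isEntireOfExpType_bandSynthesis (Lp.integrableOn_Icc _ _ _), hk2,
    fun f hf hf2 => ?_⟩
  have hk3 : hk2.toLp _ = 𝓕⁻ ψ := by
    refine Lp.ext ?_
    filter_upwards [hk2.coeFn_toLp, fourierInv_ae_eq_bandSynthesis hψ] with x h3 h4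
    rw [h3, h4]
  have hsupp := fourier_ae_eq_zero_of_notMem_Icc hh hf hf2
  have h1 := hrep _ (bandProj_eq_self_iff.2 hsupp)
  rw [FourierTransform.fourierInv_fourier_eq] at h1
  rw [weightedInner_eq_inner_mulL2 hν hm hf2 hk2, hk3, h1, L2.inner_def]
  have hf0 := congrFun (eq_bandSynthesis_fourier hh hf hf2) w
  rw [hf0, bandSynthesis, ← integral_indicator measurableSet_Icc]
  refine integral_congr_ae ?_
  filter_upwards [hE2.coeFn_toLp] with t h3
  rw [h3]
  by_cases ht : t ∈ Set.Icc (-h) h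
  · rw [hE, Set.indicator_of_mem ht, Set.indicator_of_mem ht, RCLike.inner_apply,
      Complex.conj_conj]
  · rw [hE, Set.indicator_of_notMem ht, Set.indicator_of_notMem ht]
    simp

theorem reproducing_element_unique {τ : ℝ} {ν : Measure ℝ} {W : ℝ → ℝ}
    (hν : ∀ x, measureFourier ν x = W x) (hm : MemLp (fun x => (W x : ℂ)) ∞)
    {δ : ℝ} (hδ0 : 0 < δ) (hδ : ∀ x, δ ≤ W x) {k₁ k₂ : ℂ → ℂ}
    (h₁ : IsEntireOfExpType τ k₁) (h₁' : MemLp (fun x : ℝ => k₁ x) 2)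
    (h₂ : IsEntireOfExpType τ k₂) (h₂' : MemLp (fun x : ℝ => k₂ x) 2)
    (heq : ∀ f : ℂ → ℂ, IsEntireOfExpType τ f → MemLp (fun x : ℝ => f x) 2 →
      weightedInner ν f k₁ = weightedInner ν f k₂) : k₁ = k₂ := by
  have hd : MemLp (fun x : ℝ => k₁ x - k₂ x) 2 := h₁'.sub h₂'
  have h1 := heq _ (h₁.sub h₂) hd
  have e : hd.toLp _ = h₁'.toLp _ - h₂'.toLp _ := MemLp.toLp_sub h₁' h₂'
  rw [weightedInner_eq_inner_mulL2 hν hm hd h₁', weightedInner_eq_inner_mulL2 hν hm hd h₂',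
    ← sub_eq_zero, ← inner_sub_left, ← map_sub, ← e] at h1
  have h3 := le_re_inner_mulL2 hm hδ (hd.toLp _)
  rw [h1, Complex.zero_re] at h3
  have h4 : hd.toLp _ = 0 := by
    rw [← norm_eq_zero]
    by_contra h5
    have : 0 < ‖hd.toLp _‖ := lt_of_le_of_ne (norm_nonneg _) (Ne.symm h5)
    have : 0 < δ * ‖hd.toLp _‖ ^ 2 := by positivity
    linarith
  refine h₁.1.eq_of_ae_eq_ofReal h₂.1 ?_
  filter_upwards [hd.coeFn_toLp, Lp.coeFn_zero ℂ 2 (volume : Measure ℝ)] with x h5 h6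
  rw [h4, h6] at h5
  exact (sub_eq_zero.1 h5.symm)

/-! ### The kernel at the origin -/

theorem integral_abs_sub_mul_cos {h b s : ℝ} (hb : b ≠ 0) (hs : s ∈ Set.Icc (-h) h) :
    ∫ t in (-h)..h, |s - t| * Real.cos (b * t)
      = -2 * Real.cos (b * s) / b ^ 2 + 2 * h * Real.sin (b * h) / b
        + 2 * Real.cos (b * h) / b ^ 2 := by
  -- A primitive of `(s - t) cos(bt)`.
  set G : ℝ → ℝ := fun t => (s - t) * Real.sin (b * t) / b - Real.cos (b * t) / b ^ 2 with hG
  have hderiv : ∀ t, HasDerivAt G ((s - t) * Real.cos (b * t)) t := by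
    intro t
    have h1 : HasDerivAt (fun t : ℝ => b * t) b t := by
      simpa using (hasDerivAt_id t).const_mul b
    have h2 := ((((hasDerivAt_id t).const_sub s).mul h1.sin).div_const b).sub
      (h1.cos.div_const (b ^ 2))
    refine h2.congr_deriv ?_
    rw [id]
    field_simp
    ring
  have hint : ∀ x y, ∫ t in x..y, (s - t) * Real.cos (b * t) = G y - G x := fun x y =>
    intervalIntegral.integral_eq_sub_of_hasDerivAt (fun t _ => hderiv t)
      (Continuous.intervalIntegrable (by fun_prop) _ _)
  have hc : Continuous fun t => |s - t| * Real.cos (b * t) := by fun_prop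
  rw [← intervalIntegral.integral_add_adjacent_intervals (b := s) (hc.intervalIntegrable _ _)
    (hc.intervalIntegrable _ _)]
  have h1 : ∫ t in (-h)..s, |s - t| * Real.cos (b * t) = G s - G (-h) := by
    rw [← hint]
    refine intervalIntegral.integral_congr fun t ht => ?_
    rw [Set.uIcc_of_le hs.1] at ht
    rw [abs_of_nonneg (by linarith [ht.2])]
  have h2 : ∫ t in s..h, |s - t| * Real.cos (b * t) = -(G h - G s) := by
    rw [← hint, ← intervalIntegral.integral_neg]
    refine intervalIntegral.integral_congr fun t ht => ?_
    rw [Set.uIcc_of_le hs.2] at ht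
    rw [abs_of_nonpos (by linarith [ht.1])]
    ring
  rw [h1, h2, hG]
  simp only [mul_neg, Real.sin_neg, Real.cos_neg]
  field_simp
  ring

theorem bandSynthesis_ofReal_apply_zero {h : ℝ} (hh : 0 ≤ h) (u : ℝ → ℝ) :
    bandSynthesis h (fun t => (u t : ℂ)) 0 = ((∫ t in (-h)..h, u t : ℝ) : ℂ) := by
  rw [bandSynthesis, intervalIntegral.integral_of_le (by linarith),
    ← integral_Icc_eq_integral_Ioc, ← integral_complex_ofReal]
  simp

/-- The solution `cos(2lt) / (c₁ (cos(lΔ) + lΔ sin(lΔ)))` of the integral equation `c₁ u(s) + c₂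
∫_{-Δ/2}^{Δ/2} |s - t| u(t) dt = 1`, where `l² = c₂ / (2 c₁)`: two differentiations turn the
equation into `c₁ u″ + 2 c₂ u = 0`. -/
noncomputable def cosProfile (Δ c₁ l : ℝ) (t : ℝ) : ℝ :=
  Real.cos (2 * l * t) / (c₁ * (Real.cos (l * Δ) + l * Δ * Real.sin (l * Δ)))

theorem cosProfile_integral_equation {h c₁ c₂ l : ℝ} (hc₁ : 0 < c₁) (hl : 0 < l)
    (hl2 : c₂ = 2 * c₁ * l ^ 2)
    (hD : 0 < Real.cos (l * (2 * h)) + l * (2 * h) * Real.sin (l * (2 * h))) {s : ℝ}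
    (hs : s ∈ Set.Icc (-h) h) :
    c₁ * cosProfile (2 * h) c₁ l s
      + c₂ * ∫ t in (-h)..h, |s - t| * cosProfile (2 * h) c₁ l t = 1 := by
  simp only [cosProfile]
  simp_rw [← mul_div_assoc]
  rw [intervalIntegral.integral_div, integral_abs_sub_mul_cos (by positivity) hs,
    show 2 * l * h = l * (2 * h) by ring, hl2, mul_div_assoc', ← add_div,
    div_eq_one_iff_eq (by positivity)]
  field_simp
  ring

theorem integral_cosProfile {h c₁ l : ℝ} (hl : l ≠ 0) :
    ∫ t in (-h)..h, cosProfile (2 * h) c₁ l t = 1 / (c₁ * l) * (Real.sin (l * (2 * h)) /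
      (Real.cos (l * (2 * h)) + l * (2 * h) * Real.sin (l * (2 * h)))) := by
  simp only [cosProfile]
  rw [intervalIntegral.integral_div, intervalIntegral.integral_comp_mul_left (fun t => Real.cos t)
    (by positivity), integral_cos, show 2 * l * h = l * (2 * h) by ring,
    show 2 * l * -h = -(l * (2 * h)) by ring, Real.sin_neg, smul_eq_mul]
  rw [one_div, mul_inv, mul_inv, div_eq_mul_inv, div_eq_mul_inv, mul_inv]
  ring

theorem theorem4 (Δ c₁ c₂ : ℝ) (hΔ : 0 < Δ) (hc₁ : 0 < c₁) (hc₂ : 0 ≤ c₂)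
    (h : c₂ / c₁ * Δ ^ 2 ≤ 5 / 3) :
    ∃ K : ℂ → ℂ → ℂ,
      IsReproducingKernel Δ (pairMeasure Δ c₁ c₂) K ∧
      (∀ K' : ℂ → ℂ → ℂ, IsReproducingKernel Δ (pairMeasure Δ c₁ c₂) K' → K' = K) ∧
      (0 < c₂ → K 0 0 =
        ((√(2 / (c₁ * c₂)) *
          (Real.sin (√(c₂ / (2 * c₁)) * Δ) /
            (Real.cos (√(c₂ / (2 * c₁)) * Δ) +
              √(c₂ / (2 * c₁)) * Δ * Real.sin (√(c₂ / (2 * c₁)) * Δ))) : ℝ) : ℂ)) ∧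
      (c₂ = 0 → K 0 0 = ((Δ / c₁ : ℝ) : ℂ)) := by
  -- The spectra live on `[-r, r]` with `r = Δ / 2`, since type `πΔ` is `2πr`.
  obtain ⟨r, rfl⟩ : ∃ r, Δ = 2 * r := ⟨Δ / 2, by ring⟩
  have hr : 0 ≤ r := by linarith
  have hτ : Real.pi * (2 * r) = 2 * Real.pi * r := by ring
  have hν := measureFourier_eq_pairWeight hΔ.le hc₁.le hc₂
  have hW := continuous_pairWeight hΔ.le c₁ c₂
  obtain ⟨C, hC⟩ := exists_abs_pairWeight_le hΔ.le c₁ c₂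
  have hδ0 : 0 < c₁ / 3000 := by positivity
  have hδ := pairWeight_lower_bound hc₁ hc₂ h
  have hm := memLp_top_ofReal hW hC
  have hmem : ∀ f : ℂ → ℂ, f ∈ weightedSpace (2 * r) (pairMeasure (2 * r) c₁ c₂) ↔
      IsEntireOfExpType (2 * Real.pi * r) f ∧ MemLp (fun x : ℝ => f x) 2 := fun f => by
    rw [mem_weightedSpace_iff hν hW hC hδ0 hδ, hτ]
  choose K hK1 hK2 hK3 using exists_reproducing_element hr hν hm hδ0 hδ
  have hzero : ∀ u : ℝ → ℝ, Continuous u →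
      (∀ s ∈ Set.Icc (-r) r, c₁ * u s + c₂ * ∫ t in (-r)..r, |s - t| * u t = 1) →
      K 0 0 = ((∫ t in (-r)..r, u t : ℝ) : ℂ) := by
    intro u hu heq
    have huc : Continuous fun t => (u t : ℂ) := by fun_prop
    have h1 : K 0 = bandSynthesis r fun t => (u t : ℂ) := by
      refine reproducing_element_unique hν hm hδ0 hδ (hK1 0) (hK2 0)
        (isEntireOfExpType_bandSynthesis huc.integrableOn_Icc)
        (memLp_bandSynthesis_of_continuous huc r) fun f hf hf2 => ?_
      rw [← hK3 0 f hf hf2]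
      exact weightedInner_bandSynthesis_eq_apply_zero hr hc₁.le hc₂ hu heq hm hf hf2
    rw [h1, bandSynthesis_ofReal_apply_zero hr]
  refine ⟨K, fun w => ⟨(hmem _).2 ⟨hK1 w, hK2 w⟩, fun f hf => ?_⟩, fun K' hK' => ?_, fun hpos => ?_,
    fun h0 => ?_⟩
  · obtain ⟨h1, h2⟩ := (hmem f).1 hf
    exact hK3 w f h1 h2
  · ext1 w
    obtain ⟨h1, h2⟩ := (hmem _).1 (hK' w).1
    refine reproducing_element_unique hν hm hδ0 hδ h1 h2 (hK1 w) (hK2 w) fun f hf hf2 => ?_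
    rw [← hK3 w f hf hf2, ← (hK' w).2 f ((hmem f).2 ⟨hf, hf2⟩)]
  · set l := √(c₂ / (2 * c₁)) with hl
    have hl0 : 0 < l := Real.sqrt_pos.2 (by positivity)
    have hl2 : l ^ 2 = c₂ / (2 * c₁) := Real.sq_sqrt (by positivity)
    have hl3 : c₂ = 2 * c₁ * l ^ 2 := by
      rw [hl2]
      field_simp
    -- The hypothesis gives `(lΔ)² ≤ 5 / 6`, so the denominator is positive.
    have hle : l * (2 * r) ≤ 1 := by
      have h1 : (l * (2 * r)) ^ 2 ≤ 1 := by
        have : (l * (2 * r)) ^ 2 = c₂ / c₁ * (2 * r) ^ 2 / 2 := by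
          rw [mul_pow, hl2]
          field_simp
        rw [this]
        linarith
      exact (sq_le_one_iff₀ (by positivity)).1 h1
    have hθ : 0 < l * (2 * r) := by positivity
    have hD : 0 < Real.cos (l * (2 * r)) + l * (2 * r) * Real.sin (l * (2 * r)) :=
      add_pos (Real.cos_pos_of_le_one (by rwa [abs_of_pos hθ]))
        (mul_pos hθ (Real.sin_pos_of_pos_of_le_one hθ hle))
    rw [hzero (cosProfile (2 * r) c₁ l) (by unfold cosProfile; fun_prop)
      (fun s hs => cosProfile_integral_equation hc₁ hl0 hl3 hD hs), integral_cosProfile hl0.ne']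
    have hsqrt : √(2 / (c₁ * c₂)) = 1 / (c₁ * l) := by
      rw [Real.sqrt_eq_iff_mul_self_eq (by positivity) (by positivity), hl3]
      field_simp
    rw [hsqrt]
  · rw [hzero (fun _ => 1 / c₁) continuous_const (fun s _ => by
      rw [h0, zero_mul, add_zero]
      field_simp)]
    congr 1
    simp
    ring
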